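/- **Setting.** Let $G=(V,E)$ be a finite simple unweighted graph, $p\in(0,1]$ and $0<\varepsilon\le e^{-1}$. The realized edge set $E_p\subseteq E$ contains each edge independently with probability $p$. Fix any deterministic rule $M$ that selects for each $A\subseteq E$ one maximum-cardinality matching $M(A)\subseteq A$, and put $$\mathrm{OPT}=\mathbb E|M(E_p)|,\qquad q_e=\Pr[e\in M(E_p)],$$ $$\tau=\frac{\varepsilon^3p}{20\log(1/\varepsilon)},\qquad R=\left\lceil\frac{2000\,\log(1/\varepsilon)\,\log(1/(\varepsilon p))}{\varepsilon^4p}\right\rceil,$$ $$N=\{e\in E:q_e<\tau\},\qquad C=E\setminus N,\qquad q^N_v=\sum_{e\in N,\,e\ni v}q_e .$$ **Algorithm.** Draw $R$ independent realizations $\mathcal E_1,\dots,\mathcal E_R$ of $G$ (each with the law of $E_p$, independent of $E_p$), query $S=\bigcup_r M(\mathcal E_r)$, and report a maximum matching of $S_p:=S\cap E_p$. **Fractional matching $x$ on $S_p$.** Let $f_e$ be the fraction of rounds $r$ with $e\in M(\mathcal E_r)$. * *Non-crucial edges.* For $e\in S_p\cap N$ put $\tilde x_e=\min\{f_e/p,\,2\tau/p\}$;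 for all other $e$ put $\tilde x_e=0$. Let $\tilde x_v=\sum_{e\ni v}\tilde x_e$. For $e\in N$ set $x_e=s_e\tilde x_e$, where $s_e$ is the minimum of $1$ and the numbers $\max\{q^N_v,\varepsilon\}/\tilde x_v$ over the endpoints $v$ of $e$ with $\tilde x_v>0$. * *Crucial edges.* Given $S$ and $R^C:=S_p\cap C$, draw a matching $\mu^C\subseteq R^C$, where $\mu$ is drawn with probability $\Pr[M(E')\cap S\cap C=\mu \mid E'\cap S\cap C=R^C]$ for an independent copy $E'$ of $E_p$. For $e=\{u,v\}\in\mu^C$ set $x_e=(1-\varepsilon)\min\{1-q^N_u,\,1-q^N_v\}$, and set $x_e=0$ for every other $e\in C$. **Theorem.** 1. In every outcome of positive probability of the draw of $\mu^C$, $x$ is a fractional matching supported on $S_p$ (that is, $x\ge0$, $x$ vanishes outside $S_p$, and $\sum_{e\ni v}x_e\le1$ for every $v$), and $$\mathbb E\Big[\sum_{e}x_e\Big]\ \ge\ (1-2\varepsilon)(4\sqrt2-5)\,\mathrm{OPT}.$$ 2. The algorithm satisfies $$\mathbb E\,|M(S\cap E_p)|\ \ge\ (1-2\varepsilon)(4\sqrt2-5)\,\mathrm{OPT}.$$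 Consequently, for every $c<4\sqrt2-5\approx0.6568$ there is an $\varepsilon\in(0,e^{-1}]$, depending only on $c$, for which the algorithm satisfies $\mathbb E|M(S\cap E_p)|\ge c\cdot\mathrm{OPT}$ for all $G$, $p$ and $M$. 3. Every vertex is incident to at most $R$ queried edges. For fixed $\varepsilon$ this is $O(\log(1/p)/p)$: there is a constant $K=K(\varepsilon)>0$ such that for all $p\in(0,1/2]$, all $G$ and $M$, every vertex is incident to at most $K\log(1/p)/p$ edges of $S$. -/

import Mathlib

/-! Stochastic matching on a finite (unweighted) graph with edge set `E`. Edge sets are finsets of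
unordered pairs; all random experiments are finite, and expectations are finite weighted sums. -/

namespace StochMatching

section

variable {V : Type*} [DecidableEq V]

/-- A set of edges is a matching if no two distinct edges of it share a vertex. -/
def IsEdgeMatching (F : Finset (Sym2 V)) : Prop :=
  ∀ e ∈ F, ∀ f ∈ F, ∀ v : V, v ∈ e → v ∈ f → e = f

/-- A deterministic rule `M` selecting, for every `A ⊆ E`, one maximum matching `M A` of `A`
(all edge weights are one, so maximum means maximum cardinality). -/
def IsMaxMatchingRule (E : Finset (Sym2 V)) (M : Finset (Sym2 V) → Finset (Sym2 V)) : Prop :=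
  ∀ A ⊆ E, M A ⊆ A ∧ IsEdgeMatching (M A) ∧
    ∀ F ⊆ A, IsEdgeMatching F → F.card ≤ (M A).card

/-- `x` is a fractional matching supported on the edge set `F`. -/
def IsFractionalMatching (F : Finset (Sym2 V)) (x : Sym2 V → ℝ) : Prop :=
  (∀ e, 0 ≤ x e) ∧ (∀ e, e ∉ F → x e = 0) ∧ ∀ v : V, ∑ e ∈ F with v ∈ e, x e ≤ 1

/-- The probability that the set of realized edges is exactly `A ⊆ E`, every edge of `E` being
realized independently with probability `p`. -/
noncomputable def realProb (p : ℝ) (E A : Finset (Sym2 V)) : ℝ :=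
  ∏ e ∈ E, if e ∈ A then p else 1 - p

/-- Expectation of `F (E_p)` over the random set `E_p ⊆ E` of realized edges. -/
noncomputable def expect (p : ℝ) (E : Finset (Sym2 V)) (F : Finset (Sym2 V) → ℝ) : ℝ :=
  ∑ A ∈ E.powerset, realProb p E A * F A

/-- Expectation of `F (𝓔 0, …, 𝓔 (R - 1))` over `R` independent realizations of `E`. -/
noncomputable def expectRounds (p : ℝ) (E : Finset (Sym2 V)) (R : ℕ)
    (F : (Fin R → Finset (Sym2 V)) → ℝ) : ℝ :=
  ∑ 𝓔 ∈ Fintype.piFinset (fun _ : Fin R => E.powerset), (∏ r, realProb p E (𝓔 r)) * F 𝓔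

/-- The omniscient optimum: the expected size of the maximum realized matching. -/
noncomputable def opt (p : ℝ) (E : Finset (Sym2 V)) (M : Finset (Sym2 V) → Finset (Sym2 V)) : ℝ :=
  expect p E (fun A => ((M A).card : ℝ))

/-- The number of rounds `R`, rounded up to an integer. -/
noncomputable def numRounds (ε p : ℝ) : ℕ :=
  ⌈2000 * Real.log (1 / ε) * Real.log (1 / (ε * p)) / (ε ^ 4 * p)⌉₊

/-- The threshold `τ` between crucial and non-crucial edges. -/
noncomputable def threshold (ε p : ℝ) : ℝ := ε ^ 3 * p / (20 * Real.log (1 / ε))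

/-- The set `S` of edges queried by the algorithm: the union of the maximum matchings of the
sampled realizations. -/
def querySet (M : Finset (Sym2 V) → Finset (Sym2 V)) {R : ℕ} (𝓔 : Fin R → Finset (Sym2 V)) :
    Finset (Sym2 V) :=
  Finset.univ.biUnion (fun r => M (𝓔 r))

/-- `f_e`, the fraction of the rounds in which `e` belongs to the picked matching. -/
noncomputable def roundFraction (M : Finset (Sym2 V) → Finset (Sym2 V)) {R : ℕ}
    (𝓔 : Fin R → Finset (Sym2 V)) (e : Sym2 V) : ℝ :=
  ((Finset.univ.filter (fun r => e ∈ M (𝓔 r))).card : ℝ) / R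

/-- The matching probability `q_e`: the probability that `e` belongs to the selected maximum
matching of the realized edges. -/
noncomputable def matchProb (p : ℝ) (E : Finset (Sym2 V)) (M : Finset (Sym2 V) → Finset (Sym2 V))
    (e : Sym2 V) : ℝ :=
  expect p E (fun A => if e ∈ M A then 1 else 0)

/-- The set `N` of non-crucial edges. -/
noncomputable def nonCrucial (ε p : ℝ) (E : Finset (Sym2 V))
    (M : Finset (Sym2 V) → Finset (Sym2 V)) : Finset (Sym2 V) :=
  E.filter (fun e => matchProb p E M e < threshold ε p)

/-- The set `C` of crucial edges. -/
noncomputable def crucial (ε p : ℝ) (E : Finset (Sym2 V))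
    (M : Finset (Sym2 V) → Finset (Sym2 V)) : Finset (Sym2 V) :=
  E.filter (fun e => threshold ε p ≤ matchProb p E M e)

/-- The non-crucial weight `q^N_v` of a vertex `v`. -/
noncomputable def nonCrucialWeight (ε p : ℝ) (E : Finset (Sym2 V))
    (M : Finset (Sym2 V) → Finset (Sym2 V)) (v : V) : ℝ :=
  ∑ e ∈ nonCrucial ε p E M with v ∈ e, matchProb p E M e

/-- The unscaled value of an edge in the construction on non-crucial edges: it is
`min (f_e / p) (2 τ / p)` on the realized queried non-crucial edges and zero elsewhere.
`A` is the set of realized edges. -/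
noncomputable def unscaledN (ε p : ℝ) (E : Finset (Sym2 V))
    (M : Finset (Sym2 V) → Finset (Sym2 V)) {R : ℕ} (𝓔 : Fin R → Finset (Sym2 V))
    (A : Finset (Sym2 V)) (e : Sym2 V) : ℝ :=
  if e ∈ querySet M 𝓔 ∩ A ∩ nonCrucial ε p E M then
    min (roundFraction M 𝓔 e / p) (2 * threshold ε p / p)
  else 0

/-- The total unscaled value at a vertex. -/
noncomputable def unscaledNVertex (ε p : ℝ) (E : Finset (Sym2 V))
    (M : Finset (Sym2 V) → Finset (Sym2 V)) {R : ℕ} (𝓔 : Fin R → Finset (Sym2 V))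
    (A : Finset (Sym2 V)) (v : V) : ℝ :=
  ∑ e ∈ E with v ∈ e, unscaledN ε p E M 𝓔 A e

/-- The scaling factor `s_e`: starting from `1`, it is replaced, for the vertices `v` of `e` in any
order, by its minimum with `max q^N_v ε` divided by the unscaled value at `v` (a vertex with
unscaled value zero imposes no constraint). -/
noncomputable def scaling [Fintype V] (ε p : ℝ) (E : Finset (Sym2 V))
    (M : Finset (Sym2 V) → Finset (Sym2 V)) {R : ℕ} (𝓔 : Fin R → Finset (Sym2 V))
    (A : Finset (Sym2 V)) (e : Sym2 V) : ℝ :=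
  (Finset.univ.filter (fun v : V => v ∈ e)).fold min 1 (fun v =>
    if unscaledNVertex ε p E M 𝓔 A v = 0 then 1
    else max (nonCrucialWeight ε p E M v) ε / unscaledNVertex ε p E M 𝓔 A v)

/-- The fractional matching `x^N` on the realized queried non-crucial edges. -/
noncomputable def fracN [Fintype V] (ε p : ℝ) (E : Finset (Sym2 V))
    (M : Finset (Sym2 V) → Finset (Sym2 V)) {R : ℕ} (𝓔 : Fin R → Finset (Sym2 V))
    (A : Finset (Sym2 V)) (e : Sym2 V) : ℝ :=
  unscaledN ε p E M 𝓔 A e * scaling ε p E M 𝓔 A e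

/-- The appearance probability `q(μ | R^C)`, where `T` is the set of queried crucial edges and
`RC ⊆ T` the set of those which are realized: the conditional probability, over a random
realization `E_p` given `E_p ∩ T = RC`, of the event `M (E_p) ∩ T = μ`. -/
noncomputable def appearProb (p : ℝ) (E : Finset (Sym2 V)) (M : Finset (Sym2 V) → Finset (Sym2 V))
    (T RC μ : Finset (Sym2 V)) : ℝ :=
  expect p E (fun B => if M B ∩ T = μ ∧ B ∩ T = RC then 1 else 0) /
    expect p E (fun B => if B ∩ T = RC then 1 else 0)

/-- The fractional matching `x^C` on the crucial edges, given the drawn matching `μ`. -/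
noncomputable def fracC (ε p : ℝ) (E : Finset (Sym2 V))
    (M : Finset (Sym2 V) → Finset (Sym2 V)) (μ : Finset (Sym2 V)) (e : Sym2 V) : ℝ :=
  if e ∈ μ then
    (1 - ε) * Sym2.lift ⟨fun u v =>
      min (1 - nonCrucialWeight ε p E M u) (1 - nonCrucialWeight ε p E M v),
      fun _ _ => min_comm _ _⟩ e
  else 0

/-- The combined fractional matching: `x^N` on non-crucial edges and `x^C` on crucial edges. -/
noncomputable def frac [Fintype V] (ε p : ℝ) (E : Finset (Sym2 V))
    (M : Finset (Sym2 V) → Finset (Sym2 V)) {R : ℕ} (𝓔 : Fin R → Finset (Sym2 V))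
    (A μ : Finset (Sym2 V)) (e : Sym2 V) : ℝ :=
  if e ∈ nonCrucial ε p E M then fracN ε p E M 𝓔 A e
  else if e ∈ crucial ε p E M then fracC ε p E M μ e
  else 0

/-- The expected size of the combined fractional matching. The expectation is over the samples `𝓔`
of the algorithm, the independent realization `A`, and the matching `μ` that is drawn from the
realized queried crucial edges with its appearance probability (which vanishes unless `μ` is a
matching). -/
noncomputable def expectedFracSize [Fintype V] (ε p : ℝ) (E : Finset (Sym2 V))
    (M : Finset (Sym2 V) → Finset (Sym2 V)) : ℝ :=
  expectRounds p E (numRounds ε p) (fun 𝓔 => expect p E (fun A =>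
    ∑ μ ∈ (querySet M 𝓔 ∩ crucial ε p E M ∩ A).powerset,
      appearProb p E M (querySet M 𝓔 ∩ crucial ε p E M) (querySet M 𝓔 ∩ crucial ε p E M ∩ A) μ *
        ∑ e ∈ E, frac ε p E M 𝓔 A μ e))

/-- The expected size of the matching reported by the algorithm, that is, of a maximum matching
among the realized queried edges. -/
noncomputable def algValue (ε p : ℝ) (E : Finset (Sym2 V))
    (M : Finset (Sym2 V) → Finset (Sym2 V)) : ℝ :=
  expectRounds p E (numRounds ε p) (fun 𝓔 => expect p E (fun A =>
    ((M (querySet M 𝓔 ∩ A)).card : ℝ)))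

/-- The number of queried edges at the vertex `v`. -/
def queriesAt (M : Finset (Sym2 V) → Finset (Sym2 V)) {R : ℕ} (𝓔 : Fin R → Finset (Sym2 V))
    (v : V) : ℕ :=
  ((querySet M 𝓔).filter (fun e => v ∈ e)).card

end

end StochMatching

open StochMatching

/-! The value of the fractional matching is computed in expectation and then rounded.

On the non-crucial edges, the value `x̃_v` at a vertex before scaling is at most a sum with mean
`a = q^N_v` and variance at most `a (τ + 2 / R) / p = O(ε³ a)` (`variance_untruncated_le`). Hence
its expected excess over `max a ε` is only `O(ε a)` (`expected_excess_le`), and since scaling loses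
at most the total excess over the vertices (`sum_unscaledN_sub_excess_le_sum_fracN`), at least
`(1 - ε / 2) q(N)` survives (`expected_sum_fracN_ge`). Second moments are enough; no exponential
concentration is needed.

On the crucial edges, the drawn matching has, given the queried set `S`, the law of
`M (E_p) ∩ S ∩ C` (`expect_sum_appearProb`), and a crucial edge is missing from `S` with
probability at most `ε / 100`. So the expected value is essentially the sum of
`q_e (1 - max (q^N_u) (q^N_v))` over the crucial edges `e = {u, v}` (`expected_sum_fracC_ge`).

To compare with the optimum `∑ q_e`, charge every crucial edge to its endpoint of larger non-crucial
weight. If `v` has non-crucial weight `a` and is charged `c`, then `a + c ≤ 1`, and the claim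
reduces to `a c ≤ (6 - 4√2) (a / 2 + c)`, which after homogenisation is `(a - √2 c)² ≥ 0`
(`vertex_inequality`, `sum_residual_ge`).

For the algorithm, `x` is rounded to an integral matching. A small odd vertex set of size `2 k + 1`
contains at most `k` edges of the drawn crucial matching, each of value at most `1 - ε`, and
non-crucial edges of total value at most `k ε`; for a large one the vertex constraints nearly give
the odd set constraint (`sum_frac_odd_le`). So `x` satisfies all odd set constraints up to a factor
`1 + ε² / 4`, and the Tutte–Berge bound, obtained from Tutte's theorem, yields a matching of size at
least `∑ x_e / (1 + ε² / 4)` (`fractionalMatching_sum_le_mul`). The slack left in `1 - 2 ε` pays for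
this factor. -/

namespace StochMatching

/-! ### Matchings from odd set constraints -/

/-- The join of the graph with edge set `F` and a complete graph on `d` new vertices. -/
def joinComplete {V : Type*} (F : Finset (Sym2 V)) (d : ℕ) : SimpleGraph (V ⊕ Fin d) where
  Adj a b := a ≠ b ∧ ∀ u v, a = Sum.inl u → b = Sum.inl v → s(u, v) ∈ F
  symm := ⟨fun a b h => ⟨h.1.symm, fun u v hu hv => by
    rw [Sym2.eq_swap]; exact h.2 v u hv hu⟩⟩
  loopless := ⟨fun _ h => h.1 rfl⟩

theorem card_filter_mem_sym2_le {V : Type*} [Fintype V] [DecidableEq V] (e : Sym2 V) :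
    (Finset.univ.filter (fun v => v ∈ e)).card ≤ 2 := by
  induction e with
  | _ a b =>
    refine (Finset.card_le_card (t := {a, b}) ?_).trans Finset.card_le_two
    intro v hv
    simpa using hv

/-- A perfect matching of the join spends at most `d` vertices of `V` on the new vertices, so the
rest is covered by a matching of `F`. -/
theorem exists_matching_of_joinComplete {V : Type*} [Fintype V] [DecidableEq V]
    (F : Finset (Sym2 V)) (d : ℕ) (P : (joinComplete F d).Subgraph) (hP : P.IsPerfectMatching) :
    ∃ T ⊆ F, IsEdgeMatching T ∧ Fintype.card V ≤ 2 * T.card + d := by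
  classical
  rw [SimpleGraph.Subgraph.isPerfectMatching_iff] at hP
  let T := F.filter (fun e => e.map Sum.inl ∈ P.edgeSet)
  have memT : ∀ u v, s(u, v) ∈ T ↔ P.Adj (Sum.inl u) (Sum.inl v) := by
    intro u v
    simp only [T, Finset.mem_filter, Sym2.map_mk, SimpleGraph.Subgraph.mem_edgeSet]
    exact ⟨fun h => h.2, fun h => ⟨(P.adj_sub h).2 u v rfl rfl, h⟩⟩
  refine ⟨T, Finset.filter_subset _ _, ?_, ?_⟩
  · intro e he f hf v hve hvf
    obtain ⟨a, rfl⟩ := hve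
    obtain ⟨b, rfl⟩ := hvf
    rw [memT] at he hf
    obtain ⟨w, -, hw⟩ := hP (Sum.inl v)
    have := (hw _ he).trans (hw _ hf).symm
    rw [Sum.inl.inj this]
  · have hcov : (Finset.univ : Finset V) ⊆
        (T.biUnion fun e => Finset.univ.filter (fun v => v ∈ e)) ∪
          Finset.univ.filter (fun v => ∃ i, P.Adj (Sum.inl v) (Sum.inr i)) := by
      intro v _
      obtain ⟨w, hw, -⟩ := hP (Sum.inl v)
      rcases w with w | i
      · refine Finset.mem_union_left _ (Finset.mem_biUnion.2 ⟨s(v, w), (memT _ _).2 hw, ?_⟩)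
        simp
      · refine Finset.mem_union_right _ ?_
        simpa using ⟨i, hw⟩
    have h1 : (T.biUnion fun e => Finset.univ.filter (fun v => v ∈ e)).card ≤ T.card * 2 :=
      Finset.card_biUnion_le_card_mul _ _ _ fun e _ => card_filter_mem_sym2_le e
    have h2 : (Finset.univ.filter (fun v : V => ∃ i, P.Adj (Sum.inl v) (Sum.inr i))).card ≤ d := by
      have hsub : (Finset.univ.filter (fun v : V => ∃ i, P.Adj (Sum.inl v) (Sum.inr i))) ⊆
          (Finset.univ : Finset (Fin d)).biUnion
            (fun i => Finset.univ.filter (fun v : V => P.Adj (Sum.inl v) (Sum.inr i))) := by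
        intro v hv
        simpa using hv
      refine (Finset.card_le_card hsub).trans
        ((Finset.card_biUnion_le_card_mul _ _ 1 fun i _ => Finset.card_le_one.2 ?_).trans (by simp))
      intro a ha b hb
      simp only [Finset.mem_filter, Finset.mem_univ, true_and] at ha hb
      obtain ⟨w, -, hw⟩ := hP (Sum.inr i)
      exact Sum.inl.inj ((hw _ ha.symm).trans (hw _ hb.symm).symm)
    have h3 := (Finset.card_le_card hcov).trans (Finset.card_union_le _ _)
    rw [Finset.card_univ] at h3
    omega

/-- A vertex set `W` carries at most `|W| / 2` of a fractional matching, by summing the vertex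
constraints. -/
theorem sum_inside_le_half {V : Type*} [Fintype V] [DecidableEq V]
    (F : Finset (Sym2 V)) (x : Sym2 V → ℝ) (hx : IsFractionalMatching F x)
    (hF : ∀ e ∈ F, ¬ e.IsDiag) (W : Finset V) :
    ∑ e ∈ F with (∀ v ∈ e, v ∈ W), x e ≤ (W.card : ℝ) / 2 := by
  obtain ⟨hx0, -, hxv⟩ := hx
  have h1 : ∑ v ∈ W, ∑ e ∈ F with v ∈ e, x e ≤ W.card := by
    simpa using Finset.sum_le_card_nsmul W _ 1 (fun v _ => hxv v)
  have h2 : ∑ e ∈ F with (∀ v ∈ e, v ∈ W), 2 * x e ≤ ∑ v ∈ W, ∑ e ∈ F with v ∈ e, x e := by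
    simp_rw [Finset.sum_filter]
    rw [Finset.sum_comm]
    refine Finset.sum_le_sum fun e he => ?_
    have hsum : ∑ v ∈ W, (if v ∈ e then x e else 0) = (W.filter (· ∈ e)).card * x e := by
      rw [← Finset.sum_filter, Finset.sum_const, nsmul_eq_mul]
    rw [hsum]
    split_ifs with h
    · have : 2 ≤ (W.filter (· ∈ e)).card := by
        have hd := hF e he
        induction e with
        | _ a b =>
          rw [Sym2.mk_isDiag_iff] at hd
          rw [← Finset.card_pair hd]
          refine Finset.card_le_card fun v hv => ?_
          have hv' : v ∈ s(a, b) := by simpa using hv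
          exact Finset.mem_filter.2 ⟨h v hv', hv'⟩
      have h2 : (2 : ℝ) ≤ (W.filter (· ∈ e)).card := by exact_mod_cast this
      exact mul_le_mul_of_nonneg_right h2 (hx0 e)
    · exact mul_nonneg (Nat.cast_nonneg _) (hx0 e)
  rw [← Finset.mul_sum] at h2
  linarith

/-- Upper bound on a fractional matching from a Tutte–Berge partition: the vertices labelled `none`
are deleted, the other labels are the parts that remain, and no edge joins two parts. -/
theorem fractionalMatching_sum_le_of_label {V : Type*} [Fintype V] [DecidableEq V]
    {κ : Type*} [Fintype κ] [DecidableEq κ]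
    (F : Finset (Sym2 V)) (x : Sym2 V → ℝ) (hx : IsFractionalMatching F x)
    (hF : ∀ e ∈ F, ¬ e.IsDiag) (β : ℝ) (hβ : 1 ≤ β)
    (hodd : ∀ W : Finset V, Odd W.card →
      ∑ e ∈ F with (∀ v ∈ e, v ∈ W), x e ≤ β * (((W.card : ℝ) - 1) / 2))
    (label : V → Option κ)
    (hlabel : ∀ u v, s(u, v) ∈ F → label u = none ∨ label v = none ∨ label u = label v) :
    ∑ e ∈ F, x e ≤ ((Finset.univ.filter fun v => label v = none).card : ℝ) +
      β * (((Fintype.card V : ℝ) - (Finset.univ.filter fun v => label v = none).card -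
        (Finset.univ.filter fun c : κ =>
          Odd (Finset.univ.filter fun v => label v = some c).card).card) / 2) := by
  have heven := fun W => sum_inside_le_half F x hx hF W
  obtain ⟨hx0, hxF, hxv⟩ := hx
  set part : κ → Finset V := fun c => Finset.univ.filter fun v => label v = some c with hpart
  set U : Finset V := Finset.univ.filter fun v => label v = none with hU
  have hcover : ∑ e ∈ F, x e ≤ ∑ v ∈ U, (∑ e ∈ F with v ∈ e, x e) +
      ∑ c, ∑ e ∈ F with (∀ v ∈ e, v ∈ part c), x e := by
    simp_rw [Finset.sum_filter]
    rw [Finset.sum_comm, Finset.sum_comm (s := (Finset.univ : Finset κ)), ← Finset.sum_add_distrib]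
    refine Finset.sum_le_sum fun e he => ?_
    have n1 : ∀ v ∈ U, 0 ≤ (if v ∈ e then x e else 0) := fun v _ => by
      split_ifs; exacts [hx0 e, le_rfl]
    have n2 : ∀ c ∈ (Finset.univ : Finset κ), 0 ≤ (if ∀ v ∈ e, v ∈ part c then x e else 0) :=
      fun v _ => by split_ifs; exacts [hx0 e, le_rfl]
    by_cases hUe : ∃ v ∈ e, label v = none
    · obtain ⟨v, hv, hvn⟩ := hUe
      have := Finset.single_le_sum n1 (show v ∈ U by simp [hU, hvn])
      rw [if_pos hv] at this
      linarith [Finset.sum_nonneg n2]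
    · push Not at hUe
      induction e with
      | _ a b =>
        have ha := hUe a (by simp)
        have hb := hUe b (by simp)
        have hab : label a = label b := by
          rcases hlabel a b he with h | h | h
          · exact absurd h ha
          · exact absurd h hb
          · exact h
        obtain ⟨c, hc⟩ := Option.ne_none_iff_exists'.1 ha
        have := Finset.single_le_sum n2 (Finset.mem_univ c)
        rw [if_pos] at this
        · linarith [Finset.sum_nonneg n1]
        · intro v hv
          rcases Sym2.mem_iff.1 hv with rfl | rfl
          · simpa [hpart] using hc
          · simpa [hpart, ← hab] using hc
  have hparts : ∀ c, ∑ e ∈ F with (∀ v ∈ e, v ∈ part c), x e ≤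
      β * (((part c).card - (if Odd (part c).card then (1 : ℝ) else 0)) / 2) := by
    intro c
    split_ifs with h
    · exact hodd _ h
    · refine (heven _).trans ?_
      rw [sub_zero]
      exact le_mul_of_one_le_left (by positivity) hβ
  have h1 : ∑ v ∈ U, ∑ e ∈ F with v ∈ e, x e ≤ U.card := by
    simpa using Finset.sum_le_card_nsmul U _ 1 (fun v _ => hxv v)
  have hcard : (Fintype.card V : ℝ) = U.card + ∑ c, ((part c).card : ℝ) := by
    have := Finset.card_eq_sum_card_fiberwise (f := label) (s := (Finset.univ : Finset V))
      (t := Finset.univ) (fun _ _ => Finset.mem_coe.2 (Finset.mem_univ _))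
    rw [Fintype.sum_option, Finset.card_univ] at this
    exact_mod_cast this
  have h2 := Finset.sum_le_sum fun c (_ : c ∈ (Finset.univ : Finset κ)) => hparts c
  rw [← Finset.mul_sum, ← Finset.sum_div, Finset.sum_sub_distrib, Finset.sum_boole] at h2
  have : (Fintype.card V : ℝ) - U.card = ∑ c, ((part c).card : ℝ) := by linarith
  rw [this]
  linarith

/-- If a new vertex survives the deletion of `U`, it is adjacent to everything else that does, so
the rest of the join has at most one component. -/
theorem oddComponents_joinComplete_le_one {V : Type*} [Finite V] (F : Finset (Sym2 V)) (d : ℕ)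
    (U : Set (V ⊕ Fin d)) (i : Fin d) (hi : Sum.inr i ∉ U) :
    ((⊤ : (joinComplete F d).Subgraph).deleteVerts U).coe.oddComponents.ncard ≤ 1 := by
  have hsub : Subsingleton
      ((⊤ : (joinComplete F d).Subgraph).deleteVerts U).coe.ConnectedComponent := by
    refine SimpleGraph.Preconnected.subsingleton_connectedComponent ?_
    have key : ∀ a, ((⊤ : (joinComplete F d).Subgraph).deleteVerts U).coe.Reachable a
        ⟨Sum.inr i, by simpa using hi⟩ := by
      intro a
      by_cases ha : a = ⟨Sum.inr i, by simpa using hi⟩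
      · rw [ha]
      · refine SimpleGraph.Adj.reachable ?_
        obtain ⟨a, haU⟩ := a
        have haU' : a ∉ U := by simpa using haU
        have hne : a ≠ Sum.inr i := fun h => ha (Subtype.ext h)
        have hadj : (joinComplete F d).Adj a (Sum.inr i) :=
          ⟨hne, fun _ _ _ h => by cases h⟩
        simp [haU', hi, hadj]
    exact fun a b => (key a).trans (key b).symm
  exact Set.ncard_le_one_of_subsingleton _

/-- Matching bound from odd set constraints: if a fractional matching satisfies the odd set
constraints up to the factor `β`, its size is at most `β` times the matching number. It is proved by
applying Tutte's theorem to the join with a complete graph on just too few vertices for a perfect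
matching to exist. -/
theorem fractionalMatching_sum_le_mul {V : Type*} [Fintype V] [DecidableEq V]
    (F : Finset (Sym2 V)) (x : Sym2 V → ℝ) (hx : IsFractionalMatching F x)
    (hF : ∀ e ∈ F, ¬ e.IsDiag) (β : ℝ) (hβ : 1 ≤ β)
    (hodd : ∀ W : Finset V, Odd W.card →
      ∑ e ∈ F with (∀ v ∈ e, v ∈ W), x e ≤ β * (((W.card : ℝ) - 1) / 2))
    (n : ℕ) (hn : ∀ T ⊆ F, IsEdgeMatching T → T.card ≤ n) :
    ∑ e ∈ F, x e ≤ β * n := by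
  classical
  have hβ0 : 0 ≤ β := by linarith
  by_cases hsmall : Fintype.card V ≤ 2 * n + 1
  · have h := fractionalMatching_sum_le_of_label F x hx hF β hβ hodd (fun _ => some ()) (by simp)
    refine h.trans ?_
    simp only [reduceCtorEq, Finset.filter_false, Finset.card_empty, Finset.filter_true,
      Finset.card_univ, Nat.cast_zero, zero_add, sub_zero, Finset.filter_const]
    refine mul_le_mul_of_nonneg_left ?_ hβ0
    split_ifs with ho
    · have : (Fintype.card V : ℝ) ≤ 2 * n + 1 := by exact_mod_cast hsmall
      simp only [Finset.card_univ, Fintype.card_unit, Nat.cast_one]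
      linarith
    · have h2 : Fintype.card V ≤ 2 * n := by
        rcases Nat.lt_or_ge (2 * n) (Fintype.card V) with h | h
        · exact absurd ⟨n, le_antisymm hsmall h⟩ ho
        · exact h
      have : (Fintype.card V : ℝ) ≤ 2 * n := by exact_mod_cast h2
      simp only [Finset.card_empty, Nat.cast_zero]
      linarith
  · push Not at hsmall
    obtain ⟨d, hd⟩ : ∃ d, Fintype.card V = 2 * n + 2 + d := Nat.exists_eq_add_of_le hsmall
    have hno : ¬ ∃ P : (joinComplete F d).Subgraph, P.IsPerfectMatching := by
      rintro ⟨P, hP⟩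
      obtain ⟨T, hT, hTm, hc⟩ := exists_matching_of_joinComplete F d P hP
      have := hn T hT hTm
      omega
    rw [SimpleGraph.tutte] at hno
    push Not at hno
    obtain ⟨U, hU⟩ := hno
    unfold SimpleGraph.IsTutteViolator at hU
    set H := ((⊤ : (joinComplete F d).Subgraph).deleteVerts U).coe with hH
    have hcardH : Nat.card ((⊤ : (joinComplete F d).Subgraph).deleteVerts U).verts + U.ncard =
        2 * n + 2 + d + d := by
      have : ((⊤ : (joinComplete F d).Subgraph).deleteVerts U).verts = Uᶜ := by
        ext; simp
      rw [this, Nat.card_coe_set_eq, add_comm, Set.ncard_add_ncard_compl, Nat.card_eq_fintype_card,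
        Fintype.card_sum, Fintype.card_fin, hd]
    have hpar := H.odd_ncard_oddComponents
    -- the total number of vertices is even, so the excess of odd components is at least two
    have htwo : U.ncard + 2 ≤ H.oddComponents.ncard := by
      rcases Nat.even_or_odd H.oddComponents.ncard with h | h
      · have h' : ¬ Odd (Nat.card ((⊤ : (joinComplete F d).Subgraph).deleteVerts U).verts) := by
          rw [← hpar]; exact Nat.not_odd_iff_even.2 h
        rw [Nat.not_odd_iff_even] at h'
        obtain ⟨a, ha⟩ := h
        obtain ⟨b, hb⟩ := h'
        omega
      · have h' := hpar.1 h
        obtain ⟨a, ha⟩ := h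
        obtain ⟨b, hb⟩ := h'
        omega
    have hall : ∀ i, (Sum.inr i : V ⊕ Fin d) ∈ U := by
      intro i
      by_contra hi
      have : H.oddComponents.ncard ≤ 1 := oddComponents_joinComplete_le_one F d U i hi
      omega
    have hmem : ∀ a, a ∈ ((⊤ : (joinComplete F d).Subgraph).deleteVerts U).verts ↔ a ∉ U := by
      intro a; simp
    let label : V → Option H.ConnectedComponent := fun v =>
      if h : Sum.inl v ∈ U then none else some (H.connectedComponentMk ⟨Sum.inl v, (hmem _).2 h⟩)
    have hnone : ∀ v, label v = none ↔ Sum.inl v ∈ U := by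
      intro v; simp only [label]; split_ifs with h <;> simp [h]
    have := Fintype.ofFinite H.ConnectedComponent
    have h := fractionalMatching_sum_le_of_label F x hx hF β hβ hodd label (by
      intro u v huv
      by_cases hu : Sum.inl u ∈ U
      · exact Or.inl ((hnone u).2 hu)
      by_cases hv : Sum.inl v ∈ U
      · exact Or.inr (Or.inl ((hnone v).2 hv))
      refine Or.inr (Or.inr ?_)
      simp only [label, dif_neg hu, dif_neg hv, Option.some.injEq]
      refine SimpleGraph.ConnectedComponent.connectedComponentMk_eq_of_adj ?_
      have hne : u ≠ v := fun h => hF _ huv (by simp [h])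
      have hadj : (joinComplete F d).Adj (Sum.inl u) (Sum.inl v) :=
        ⟨fun h => hne (Sum.inl.inj h), fun a b ha hb => by
          rw [← Sum.inl.inj ha, ← Sum.inl.inj hb]; exact huv⟩
      simp [hH, hu, hv, hadj])
    have hoddc : (Finset.univ.filter fun c : H.ConnectedComponent =>
        Odd (Finset.univ.filter fun v => label v = some c).card).card = H.oddComponents.ncard := by
      rw [← Set.ncard_coe_finset]
      congr 1
      ext c
      simp only [Finset.coe_filter, Finset.mem_univ, true_and, Set.mem_ofPred_eq]
      have : (Finset.univ.filter fun v => label v = some c).card = c.supp.ncard := by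
        rw [← Set.ncard_coe_finset]
        refine Set.ncard_congr (fun v hv => ⟨Sum.inl v, (hmem _).2 fun hvU => ?_⟩) ?_ ?_ ?_
        · have hv' : label v = some c := by simpa using hv
          rw [(hnone v).2 hvU] at hv'
          cases hv'
        · intro v hv
          have hv' : label v = some c := by simpa using hv
          by_cases hvU : Sum.inl v ∈ U
          · rw [(hnone v).2 hvU] at hv'
            cases hv'
          · simp only [label, dif_neg hvU, Option.some.injEq] at hv'
            exact hv'
        · intro a b _ _ hab
          exact Sum.inl.inj (congrArg Subtype.val hab)
        · rintro ⟨v | i, hvU⟩ hv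
          · refine ⟨v, ?_, rfl⟩
            have hvU' : Sum.inl v ∉ U := (hmem _).1 hvU
            simp only [label, Finset.coe_filter, Finset.mem_univ, true_and, Set.mem_ofPred_eq,
              dif_neg hvU', Option.some.injEq]
            exact hv
          · exact absurd (hall i) ((hmem _).1 hvU)
      rw [this]
    have hUcard : U.ncard = (Finset.univ.filter fun v => label v = none).card + d := by
      have : U = ↑((Finset.univ.filter fun v => label v = none).disjSum
          (Finset.univ : Finset (Fin d))) := by
        ext a
        rcases a with v | i
        · simp [hnone]
        · simp [hall i]
      rw [congrArg Set.ncard this, Set.ncard_coe_finset, Finset.card_disjSum, Finset.card_univ,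
        Fintype.card_fin]
    rw [hoddc] at h
    refine h.trans ?_
    set u := (Finset.univ.filter fun v => label v = none).card with hu
    have e1 : ((u : ℝ) + d) + 2 ≤ H.oddComponents.ncard := by
      rw [hUcard] at htwo; exact_mod_cast htwo
    have e2 : (Fintype.card V : ℝ) = 2 * n + 2 + d := by exact_mod_cast hd
    have e3 : (u : ℝ) ≤ β * u := le_mul_of_one_le_left (Nat.cast_nonneg _) hβ
    have e4 : β * (((Fintype.card V : ℝ) - u - H.oddComponents.ncard) / 2) ≤ β * (n - u) :=
      mul_le_mul_of_nonneg_left (by linarith) hβ0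
    linarith

/-! ### Expectations over one realization -/

section Expectation

variable {V : Type*} [DecidableEq V] {p : ℝ} {E : Finset (Sym2 V)}

theorem sum_powerset_prod_ite {α : Type*} [DecidableEq α] (E : Finset α) (f g : α → ℝ) :
    ∑ A ∈ E.powerset, ∏ e ∈ E, (if e ∈ A then f e else g e) = ∏ e ∈ E, (f e + g e) := by
  rw [Finset.prod_add]
  refine Finset.sum_congr rfl fun A hA => ?_
  have hA' := Finset.mem_powerset.1 hA
  rw [← Finset.prod_sdiff hA', mul_comm]
  congr 1
  · exact Finset.prod_congr rfl fun e he => if_pos he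
  · exact Finset.prod_congr rfl fun e he => if_neg (Finset.mem_sdiff.1 he).2

theorem realProb_nonneg (hp0 : 0 ≤ p) (hp1 : p ≤ 1) (A : Finset (Sym2 V)) :
    0 ≤ realProb p E A :=
  Finset.prod_nonneg fun e _ => by split_ifs <;> linarith

theorem expect_indicator_subset (p : ℝ) {D : Finset (Sym2 V)} (hD : D ⊆ E) :
    expect p E (fun A => if D ⊆ A then 1 else 0) = p ^ D.card := by
  have h1 : expect p E (fun A => if D ⊆ A then 1 else 0) =
      ∑ A ∈ E.powerset, ∏ e ∈ E, (if e ∈ A then p else if e ∈ D then 0 else 1 - p) := by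
    refine Finset.sum_congr rfl fun A _ => ?_
    unfold realProb
    beta_reduce
    split_ifs with h
    · rw [mul_one]
      refine Finset.prod_congr rfl fun e _ => ?_
      by_cases he : e ∈ A
      · simp [he]
      · rw [if_neg he, if_neg he, if_neg fun h' => he (h h')]
    · rw [mul_zero]
      obtain ⟨e, heD, heA⟩ := Finset.not_subset.1 h
      exact (Finset.prod_eq_zero (hD heD) (by simp [heD, heA])).symm
  have h2 : ∏ e ∈ E \ D, (p + if e ∈ D then 0 else 1 - p) = 1 :=
    Finset.prod_eq_one fun e he => by simp [(Finset.mem_sdiff.1 he).2]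
  have h3 : ∏ e ∈ D, (p + if e ∈ D then 0 else 1 - p) = ∏ _e ∈ D, p :=
    Finset.prod_congr rfl fun e he => by simp [he]
  rw [h1, sum_powerset_prod_ite, ← Finset.prod_sdiff hD, h2, h3, one_mul, Finset.prod_const]

theorem expect_const (p c : ℝ) : expect p E (fun _ => c) = c := by
  have h : expect p E (fun A => if (∅ : Finset (Sym2 V)) ⊆ A then 1 else 0) = p ^ 0 :=
    expect_indicator_subset p (Finset.empty_subset E)
  simp only [Finset.empty_subset, if_true, pow_zero, expect, mul_one] at h
  rw [expect, ← Finset.sum_mul, h, one_mul]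

theorem expect_indicator_mem (p : ℝ) {e : Sym2 V} (he : e ∈ E) :
    expect p E (fun A => if e ∈ A then 1 else 0) = p := by
  have := expect_indicator_subset p (Finset.singleton_subset_iff.2 he)
  simpa using this

theorem expect_add (p : ℝ) (F G : Finset (Sym2 V) → ℝ) :
    expect p E (fun A => F A + G A) = expect p E F + expect p E G := by
  simp [expect, mul_add, Finset.sum_add_distrib]

theorem expect_sub (p : ℝ) (F G : Finset (Sym2 V) → ℝ) :
    expect p E (fun A => F A - G A) = expect p E F - expect p E G := by
  simp [expect, mul_sub, Finset.sum_sub_distrib]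

theorem expect_const_mul (p c : ℝ) (F : Finset (Sym2 V) → ℝ) :
    expect p E (fun A => c * F A) = c * expect p E F := by
  simp only [expect, Finset.mul_sum]
  exact Finset.sum_congr rfl fun _ _ => by ring

theorem expect_sum {ι : Type*} (p : ℝ) (s : Finset ι) (F : ι → Finset (Sym2 V) → ℝ) :
    expect p E (fun A => ∑ i ∈ s, F i A) = ∑ i ∈ s, expect p E (F i) := by
  simp only [expect, Finset.mul_sum]
  exact Finset.sum_comm

theorem expect_congr (p : ℝ) {F G : Finset (Sym2 V) → ℝ} (h : ∀ A ⊆ E, F A = G A) :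
    expect p E F = expect p E G :=
  Finset.sum_congr rfl fun A hA => by rw [h A (Finset.mem_powerset.1 hA)]

theorem expect_mono (hp0 : 0 ≤ p) (hp1 : p ≤ 1) {F G : Finset (Sym2 V) → ℝ}
    (h : ∀ A ⊆ E, F A ≤ G A) : expect p E F ≤ expect p E G :=
  Finset.sum_le_sum fun A hA =>
    mul_le_mul_of_nonneg_left (h A (Finset.mem_powerset.1 hA)) (realProb_nonneg hp0 hp1 A)

theorem expect_nonneg (hp0 : 0 ≤ p) (hp1 : p ≤ 1) {F : Finset (Sym2 V) → ℝ}
    (h : ∀ A ⊆ E, 0 ≤ F A) : 0 ≤ expect p E F := by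
  have := expect_mono hp0 hp1 h
  rwa [expect_const] at this

/-! ### Expectations over independent rounds -/

variable {R : ℕ}

theorem expectRounds_prod (p : ℝ) (g : Fin R → Finset (Sym2 V) → ℝ) :
    expectRounds p E R (fun 𝓔 => ∏ r, g r (𝓔 r)) = ∏ r, expect p E (g r) := by
  simp only [expectRounds, expect, Finset.prod_univ_sum, Finset.prod_mul_distrib]

theorem expectRounds_const (p c : ℝ) : expectRounds p E R (fun _ => c) = c := by
  have h := expectRounds_prod (E := E) (R := R) p (fun _ _ => 1)
  simp only [expect_const, Finset.prod_const_one, expectRounds, mul_one] at h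
  rw [expectRounds, ← Finset.sum_mul, h, one_mul]

theorem expectRounds_eval (p : ℝ) (r : Fin R) (g : Finset (Sym2 V) → ℝ) :
    expectRounds p E R (fun 𝓔 => g (𝓔 r)) = expect p E g := by
  have h := expectRounds_prod (E := E) (R := R) p (fun t A => if t = r then g A else 1)
  rw [Finset.prod_eq_single r (fun t _ ht => by simp [ht, expect_const]) (by simp)] at h
  simpa using h

theorem expectRounds_eval_mul (p : ℝ) {r s : Fin R} (hrs : r ≠ s) (g h : Finset (Sym2 V) → ℝ) :
    expectRounds p E R (fun 𝓔 => g (𝓔 r) * h (𝓔 s)) = expect p E g * expect p E h := by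
  have key := expectRounds_prod (E := E) (R := R) p
    (fun t A => (if t = r then g A else 1) * (if t = s then h A else 1))
  simp only [Finset.prod_mul_distrib, Finset.prod_ite_eq', Finset.mem_univ, if_true] at key
  rw [key]
  have : ∀ t, expect p E (fun A => (if t = r then g A else 1) * (if t = s then h A else 1)) =
      (if t = r then expect p E g else 1) * (if t = s then expect p E h else 1) := by
    intro t
    by_cases h1 : t = r
    · have h2 : t ≠ s := fun h' => hrs (h1.symm.trans h')
      simp [h1, hrs]
    · by_cases h2 : t = s
      · simp [h2, hrs.symm]
      · simp [h1, h2, expect_const]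
  simp only [this, Finset.prod_mul_distrib, Finset.prod_ite_eq', Finset.mem_univ, if_true]

theorem expectRounds_add (p : ℝ) (F G : (Fin R → Finset (Sym2 V)) → ℝ) :
    expectRounds p E R (fun 𝓔 => F 𝓔 + G 𝓔) = expectRounds p E R F + expectRounds p E R G := by
  simp [expectRounds, mul_add, Finset.sum_add_distrib]

theorem expectRounds_sub (p : ℝ) (F G : (Fin R → Finset (Sym2 V)) → ℝ) :
    expectRounds p E R (fun 𝓔 => F 𝓔 - G 𝓔) = expectRounds p E R F - expectRounds p E R G := by
  simp [expectRounds, mul_sub, Finset.sum_sub_distrib]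

theorem expectRounds_const_mul (p c : ℝ) (F : (Fin R → Finset (Sym2 V)) → ℝ) :
    expectRounds p E R (fun 𝓔 => c * F 𝓔) = c * expectRounds p E R F := by
  simp only [expectRounds, Finset.mul_sum]
  exact Finset.sum_congr rfl fun _ _ => by ring

theorem expectRounds_sum {ι : Type*} (p : ℝ) (s : Finset ι)
    (F : ι → (Fin R → Finset (Sym2 V)) → ℝ) :
    expectRounds p E R (fun 𝓔 => ∑ i ∈ s, F i 𝓔) = ∑ i ∈ s, expectRounds p E R (F i) := by
  simp only [expectRounds, Finset.mul_sum]
  exact Finset.sum_comm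

theorem expectRounds_mono (hp0 : 0 ≤ p) (hp1 : p ≤ 1) {F G : (Fin R → Finset (Sym2 V)) → ℝ}
    (h : ∀ 𝓔, (∀ r, 𝓔 r ⊆ E) → F 𝓔 ≤ G 𝓔) : expectRounds p E R F ≤ expectRounds p E R G :=
  Finset.sum_le_sum fun 𝓔 h𝓔 =>
    mul_le_mul_of_nonneg_left
      (h 𝓔 fun r => Finset.mem_powerset.1 (Fintype.mem_piFinset.1 h𝓔 r))
      (Finset.prod_nonneg fun r _ => realProb_nonneg hp0 hp1 (𝓔 r))

theorem expectRounds_congr (p : ℝ) {F G : (Fin R → Finset (Sym2 V)) → ℝ}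
    (h : ∀ 𝓔, (∀ r, 𝓔 r ⊆ E) → F 𝓔 = G 𝓔) : expectRounds p E R F = expectRounds p E R G :=
  Finset.sum_congr rfl fun 𝓔 h𝓔 => by
    rw [h 𝓔 fun r => Finset.mem_powerset.1 (Fintype.mem_piFinset.1 h𝓔 r)]

theorem expectRounds_average (p : ℝ) (hR : 0 < R) (g : Finset (Sym2 V) → ℝ) :
    expectRounds p E R (fun 𝓔 => (∑ r, g (𝓔 r)) / R) = expect p E g := by
  have hR' : (R : ℝ) ≠ 0 := by positivity
  simp_rw [div_eq_inv_mul]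
  rw [expectRounds_const_mul, expectRounds_sum]
  simp_rw [expectRounds_eval]
  simp [hR']

/-- Second moment of the average over `R` independent rounds: the variance is at most the second
moment of one round, divided by `R`. -/
theorem expectRounds_average_sq_le (p : ℝ) (hR : 0 < R) (g : Finset (Sym2 V) → ℝ) :
    expectRounds p E R (fun 𝓔 => ((∑ r, g (𝓔 r)) / R) ^ 2) ≤
      expect p E g ^ 2 + expect p E (fun A => g A ^ 2) / R := by
  have hR' : (0 : ℝ) < R := by positivity
  have h1 : ∀ 𝓔 : Fin R → Finset (Sym2 V), ((∑ r, g (𝓔 r)) / R) ^ 2 =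
      ((R : ℝ) ^ 2)⁻¹ * ∑ r, ∑ s, g (𝓔 r) * g (𝓔 s) := by
    intro 𝓔
    rw [← Finset.sum_mul_sum]
    field_simp
  simp_rw [h1]
  rw [expectRounds_const_mul, expectRounds_sum]
  simp_rw [expectRounds_sum]
  have h2 : ∀ r s : Fin R, expectRounds p E R (fun 𝓔 => g (𝓔 r) * g (𝓔 s)) ≤
      expect p E g ^ 2 + if r = s then expect p E (fun A => g A ^ 2) else 0 := by
    intro r s
    split_ifs with h
    · subst h
      rw [expectRounds_eval p r (fun A => g A * g A)]
      simp_rw [← sq]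
      linarith [sq_nonneg (expect p E g)]
    · rw [expectRounds_eval_mul p h, sq, add_zero]
  have h3 := Finset.sum_le_sum fun r (_ : r ∈ (Finset.univ : Finset (Fin R))) =>
    Finset.sum_le_sum fun s (_ : s ∈ (Finset.univ : Finset (Fin R))) => h2 r s
  refine (mul_le_mul_of_nonneg_left h3 (by positivity)).trans (le_of_eq ?_)
  simp only [Finset.sum_add_distrib, Finset.sum_const, Finset.card_univ, Fintype.card_fin,
    nsmul_eq_mul, Finset.sum_ite_eq, Finset.mem_univ, if_true]
  field_simp

end Expectation

/-! ### Matching probabilities -/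

theorem IsEdgeMatching.subset {V : Type*} {F F' : Finset (Sym2 V)} (hF : IsEdgeMatching F)
    (h : F' ⊆ F) :
    IsEdgeMatching F' :=
  fun e he f hf => hF e (h he) f (h hf)

section Matching

variable {V : Type*} [DecidableEq V] {ε p : ℝ} {E : Finset (Sym2 V)}
  {M : Finset (Sym2 V) → Finset (Sym2 V)}

theorem IsEdgeMatching.card_filter_mem_le_one {F : Finset (Sym2 V)} (hF : IsEdgeMatching F)
    (v : V) : (F.filter (fun e => v ∈ e)).card ≤ 1 :=
  Finset.card_le_one.2 fun e he f hf =>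
    hF e (Finset.mem_filter.1 he).1 f (Finset.mem_filter.1 hf).1 v
      (Finset.mem_filter.1 he).2 (Finset.mem_filter.1 hf).2

theorem querySet_subset (hM : IsMaxMatchingRule E M) {R : ℕ} {𝓔 : Fin R → Finset (Sym2 V)}
    (h𝓔 : ∀ r, 𝓔 r ⊆ E) : querySet M 𝓔 ⊆ E :=
  Finset.biUnion_subset.2 fun r _ => ((hM _ (h𝓔 r)).1).trans (h𝓔 r)

theorem queriesAt_le (hM : IsMaxMatchingRule E M) {R : ℕ} {𝓔 : Fin R → Finset (Sym2 V)}
    (h𝓔 : ∀ r, 𝓔 r ⊆ E) (v : V) : queriesAt M 𝓔 v ≤ R := by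
  unfold queriesAt querySet
  rw [Finset.filter_biUnion]
  refine (Finset.card_biUnion_le_card_mul _ _ 1 fun r _ =>
    ((hM _ (h𝓔 r)).2.1).card_filter_mem_le_one v).trans (by simp)

theorem matchProb_nonneg (hp0 : 0 ≤ p) (hp1 : p ≤ 1) (e : Sym2 V) : 0 ≤ matchProb p E M e :=
  expect_nonneg hp0 hp1 fun A _ => by split_ifs <;> norm_num

theorem matchProb_le_one (hp0 : 0 ≤ p) (hp1 : p ≤ 1) (e : Sym2 V) : matchProb p E M e ≤ 1 := by
  rw [← expect_const (E := E) p 1]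
  exact expect_mono hp0 hp1 fun A _ => by split_ifs <;> norm_num

theorem sum_matchProb (p : ℝ) (D : Finset (Sym2 V)) :
    ∑ e ∈ D, matchProb p E M e = expect p E (fun A => ((D.filter (· ∈ M A)).card : ℝ)) := by
  simp only [matchProb]
  rw [← expect_sum]
  simp [Finset.filter_mem_eq_inter]

theorem opt_eq_sum_matchProb (hM : IsMaxMatchingRule E M) :
    opt p E M = ∑ e ∈ E, matchProb p E M e := by
  rw [sum_matchProb, opt]
  refine expect_congr p fun A hA => ?_
  have : E.filter (· ∈ M A) = M A := by
    rw [Finset.filter_mem_eq_inter, Finset.inter_eq_right]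
    exact (hM A hA).1.trans hA
  rw [this]

theorem sum_matchProb_incident_le_one (hM : IsMaxMatchingRule E M) (hp0 : 0 ≤ p) (hp1 : p ≤ 1)
    (v : V) : ∑ e ∈ E with v ∈ e, matchProb p E M e ≤ 1 := by
  rw [sum_matchProb, ← expect_const (E := E) p 1]
  refine expect_mono hp0 hp1 fun A hA => ?_
  have h : (E.filter (fun e => v ∈ e)).filter (· ∈ M A) ⊆ (M A).filter (fun e => v ∈ e) := by
    intro e he
    simp only [Finset.mem_filter] at he ⊢
    exact ⟨he.2, he.1.2⟩
  exact_mod_cast (Finset.card_le_card h).trans ((hM A hA).2.1.card_filter_mem_le_one v)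

theorem nonCrucialWeight_nonneg (hp0 : 0 ≤ p) (hp1 : p ≤ 1) (v : V) :
    0 ≤ nonCrucialWeight ε p E M v :=
  Finset.sum_nonneg fun e _ => matchProb_nonneg hp0 hp1 e

theorem sum_nonCrucial_add_sum_crucial (f : Sym2 V → ℝ) :
    ∑ e ∈ nonCrucial ε p E M, f e + ∑ e ∈ crucial ε p E M, f e = ∑ e ∈ E, f e := by
  have : crucial ε p E M = E.filter (fun e => ¬ matchProb p E M e < threshold ε p) := by
    simp [crucial]
  rw [this, nonCrucial, Finset.sum_filter_add_sum_filter_not]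

theorem nonCrucialWeight_add_sum_crucial_le_one (hM : IsMaxMatchingRule E M) (hp0 : 0 ≤ p)
    (hp1 : p ≤ 1) (v : V) :
    nonCrucialWeight ε p E M v + ∑ e ∈ crucial ε p E M with v ∈ e, matchProb p E M e ≤ 1 := by
  have := sum_matchProb_incident_le_one hM hp0 hp1 v
  rw [Finset.sum_filter, ← sum_nonCrucial_add_sum_crucial (ε := ε) (p := p) (M := M)] at this
  simpa only [nonCrucialWeight, Finset.sum_filter] using this

theorem nonCrucialWeight_le_one (hM : IsMaxMatchingRule E M) (hp0 : 0 ≤ p)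
    (hp1 : p ≤ 1) (v : V) : nonCrucialWeight ε p E M v ≤ 1 := by
  have := nonCrucialWeight_add_sum_crucial_le_one (ε := ε) hM hp0 hp1 v
  have h : 0 ≤ ∑ e ∈ crucial ε p E M with v ∈ e, matchProb p E M e :=
    Finset.sum_nonneg fun e _ => matchProb_nonneg hp0 hp1 e
  linarith

theorem exists_of_appearProb_pos {T RC μ : Finset (Sym2 V)} (h : 0 < appearProb p E M T RC μ) :
    ∃ B ⊆ E, M B ∩ T = μ := by
  by_contra hno
  push Not at hno
  have : expect p E (fun B => if M B ∩ T = μ ∧ B ∩ T = RC then 1 else 0) = 0 := by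
    rw [expect_congr (G := fun _ => 0) p, expect_const]
    intro B hB
    exact if_neg fun h => hno B hB h.1
  rw [appearProb, this, zero_div] at h
  exact lt_irrefl _ h

/-! ### The fractional matching on non-crucial edges -/

variable {R : ℕ} {𝓔 : Fin R → Finset (Sym2 V)} {A : Finset (Sym2 V)}

theorem roundFraction_nonneg (e : Sym2 V) : 0 ≤ roundFraction M 𝓔 e := by
  unfold roundFraction; positivity

theorem roundFraction_eq_average (e : Sym2 V) :
    roundFraction M 𝓔 e = (∑ r, if e ∈ M (𝓔 r) then (1 : ℝ) else 0) / R := by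
  rw [roundFraction, Finset.sum_boole]

theorem roundFraction_eq_zero {e : Sym2 V} (he : e ∉ querySet M 𝓔) : roundFraction M 𝓔 e = 0 := by
  rw [roundFraction, Finset.filter_eq_empty_iff.2]
  · simp
  · intro r _ hr
    exact he (Finset.mem_biUnion.2 ⟨r, Finset.mem_univ _, hr⟩)

/-- An edge that is not queried has `f_e = 0`, so the condition `e ∈ S` in the definition of the
unscaled value is redundant. -/
theorem unscaledN_eq (hτ : 0 ≤ threshold ε p) (hp0 : 0 ≤ p) {e : Sym2 V}
    (he : e ∈ nonCrucial ε p E M) :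
    unscaledN ε p E M 𝓔 A e =
      if e ∈ A then min (roundFraction M 𝓔 e / p) (2 * threshold ε p / p) else 0 := by
  unfold unscaledN
  by_cases hA : e ∈ A
  · by_cases hS : e ∈ querySet M 𝓔
    · simp [he, hA, hS]
    · rw [roundFraction_eq_zero hS, zero_div, min_eq_left (by positivity)]
      simp
  · simp [hA]

theorem unscaledN_eq_zero {e : Sym2 V} (he : e ∉ querySet M 𝓔 ∩ A ∩ nonCrucial ε p E M) :
    unscaledN ε p E M 𝓔 A e = 0 := if_neg he

theorem unscaledN_nonneg (hτ : 0 ≤ threshold ε p) (hp0 : 0 ≤ p) (e : Sym2 V) :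
    0 ≤ unscaledN ε p E M 𝓔 A e := by
  unfold unscaledN
  split_ifs
  · exact le_min (div_nonneg (roundFraction_nonneg e) hp0) (by positivity)
  · exact le_rfl

theorem unscaledN_le (hτ : 0 ≤ threshold ε p) (hp0 : 0 ≤ p) (e : Sym2 V) :
    unscaledN ε p E M 𝓔 A e ≤ 2 * threshold ε p / p := by
  unfold unscaledN
  split_ifs
  · exact min_le_right _ _
  · positivity

theorem unscaledNVertex_nonneg (hτ : 0 ≤ threshold ε p) (hp0 : 0 ≤ p) (v : V) :
    0 ≤ unscaledNVertex ε p E M 𝓔 A v :=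
  Finset.sum_nonneg fun e _ => unscaledN_nonneg hτ hp0 e

variable [Fintype V]

theorem scaling_le_one (e : Sym2 V) : scaling ε p E M 𝓔 A e ≤ 1 :=
  Finset.fold_min_le 1 |>.2 (Or.inl le_rfl)

theorem scaling_le_of_mem {e : Sym2 V} {v : V} (hv : v ∈ e) :
    scaling ε p E M 𝓔 A e ≤ if unscaledNVertex ε p E M 𝓔 A v = 0 then 1
      else max (nonCrucialWeight ε p E M v) ε / unscaledNVertex ε p E M 𝓔 A v :=
  (Finset.fold_min_le _).2 (Or.inr ⟨v, by simpa using hv, le_rfl⟩)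

theorem scaling_eq_one_or (e : Sym2 V) : 1 ≤ scaling ε p E M 𝓔 A e ∨
    ∃ v ∈ e, (if unscaledNVertex ε p E M 𝓔 A v = 0 then 1
      else max (nonCrucialWeight ε p E M v) ε / unscaledNVertex ε p E M 𝓔 A v) ≤
        scaling ε p E M 𝓔 A e := by
  rcases (Finset.fold_min_le (scaling ε p E M 𝓔 A e)).1 le_rfl with h | ⟨v, hv, h⟩
  · exact Or.inl h
  · exact Or.inr ⟨v, by simpa using hv, h⟩

theorem scaling_nonneg (hε : 0 ≤ ε) (hτ : 0 ≤ threshold ε p) (hp0 : 0 ≤ p) (e : Sym2 V) :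
    0 ≤ scaling ε p E M 𝓔 A e := by
  refine (Finset.le_fold_min _).2 ⟨zero_le_one, fun v _ => ?_⟩
  split_ifs
  · exact zero_le_one
  · exact div_nonneg (le_max_of_le_right hε) (unscaledNVertex_nonneg hτ hp0 v)

theorem fracN_nonneg (hε : 0 ≤ ε) (hτ : 0 ≤ threshold ε p) (hp0 : 0 ≤ p) (e : Sym2 V) :
    0 ≤ fracN ε p E M 𝓔 A e :=
  mul_nonneg (unscaledN_nonneg hτ hp0 e) (scaling_nonneg hε hτ hp0 e)

theorem fracN_le (hτ : 0 ≤ threshold ε p) (hp0 : 0 ≤ p) (e : Sym2 V) :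
    fracN ε p E M 𝓔 A e ≤ 2 * threshold ε p / p :=
  (mul_le_of_le_one_right (unscaledN_nonneg hτ hp0 e) (scaling_le_one e)).trans
    (unscaledN_le hτ hp0 e)

theorem fracN_eq_zero {e : Sym2 V} (he : e ∉ querySet M 𝓔 ∩ A ∩ nonCrucial ε p E M) :
    fracN ε p E M 𝓔 A e = 0 := by
  rw [fracN, unscaledN_eq_zero he, zero_mul]

theorem sum_fracN_incident_le (hε : 0 ≤ ε) (hτ : 0 ≤ threshold ε p) (hp0 : 0 ≤ p) (v : V) :
    ∑ e ∈ E with v ∈ e, fracN ε p E M 𝓔 A e ≤ max (nonCrucialWeight ε p E M v) ε := by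
  by_cases h0 : unscaledNVertex ε p E M 𝓔 A v = 0
  · have hle : ∑ e ∈ E with v ∈ e, fracN ε p E M 𝓔 A e ≤ unscaledNVertex ε p E M 𝓔 A v :=
      Finset.sum_le_sum fun e _ =>
        mul_le_of_le_one_right (unscaledN_nonneg hτ hp0 e) (scaling_le_one e)
    rw [h0] at hle
    exact hle.trans (le_max_of_le_right hε)
  · have hle : ∑ e ∈ E with v ∈ e, fracN ε p E M 𝓔 A e ≤
        ∑ e ∈ E with v ∈ e, unscaledN ε p E M 𝓔 A e *
          (max (nonCrucialWeight ε p E M v) ε / unscaledNVertex ε p E M 𝓔 A v) := by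
      refine Finset.sum_le_sum fun e he => ?_
      refine mul_le_mul_of_nonneg_left ?_ (unscaledN_nonneg hτ hp0 e)
      have := scaling_le_of_mem (ε := ε) (p := p) (E := E) (M := M) (𝓔 := 𝓔) (A := A)
        (Finset.mem_filter.1 he).2
      rwa [if_neg h0] at this
    rw [← Finset.sum_mul] at hle
    refine hle.trans (le_of_eq ?_)
    exact mul_div_cancel₀ _ h0

/-- The loss caused by the scaling is at most the total excess over the vertices. -/
theorem sum_unscaledN_sub_excess_le_sum_fracN (hτ : 0 ≤ threshold ε p) (hp0 : 0 ≤ p) :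
    ∑ e ∈ E, unscaledN ε p E M 𝓔 A e - ∑ v, max (unscaledNVertex ε p E M 𝓔 A v -
      max (nonCrucialWeight ε p E M v) ε) 0 ≤ ∑ e ∈ E, fracN ε p E M 𝓔 A e := by
  set X := unscaledNVertex ε p E M 𝓔 A with hX
  set u := unscaledN ε p E M 𝓔 A with hu
  let ratio : V → ℝ := fun v => if X v = 0 then 1 else max (nonCrucialWeight ε p E M v) ε / X v
  have hu0 : ∀ e, 0 ≤ u e := fun e => unscaledN_nonneg hτ hp0 e
  have hX0 : ∀ v, 0 ≤ X v := fun v => unscaledNVertex_nonneg hτ hp0 v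
  have hpt : ∀ e, u e ≤ fracN ε p E M 𝓔 A e +
      ∑ v, (if v ∈ e then u e * max (1 - ratio v) 0 else 0) := by
    intro e
    have hnn : ∀ v ∈ (Finset.univ : Finset V),
        0 ≤ (if v ∈ e then u e * max (1 - ratio v) 0 else 0) := fun v _ => by
      split_ifs
      · exact mul_nonneg (hu0 e) (le_max_right _ _)
      · exact le_rfl
    rcases scaling_eq_one_or (ε := ε) (p := p) (E := E) (M := M) (𝓔 := 𝓔) (A := A) e
      with h | ⟨v, hv, h⟩
    · have h1 : u e * 1 ≤ fracN ε p E M 𝓔 A e := mul_le_mul_of_nonneg_left h (hu0 e)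
      linarith [Finset.sum_nonneg hnn]
    · have h1 : u e * ratio v ≤ fracN ε p E M 𝓔 A e := mul_le_mul_of_nonneg_left h (hu0 e)
      have h2 := Finset.single_le_sum hnn (Finset.mem_univ v)
      rw [if_pos hv] at h2
      have h3 : u e * (1 - ratio v) ≤ u e * max (1 - ratio v) 0 :=
        mul_le_mul_of_nonneg_left (le_max_left _ _) (hu0 e)
      linarith
  have hvert : ∀ v, ∑ e ∈ E, (if v ∈ e then u e * max (1 - ratio v) 0 else 0) ≤
      max (X v - max (nonCrucialWeight ε p E M v) ε) 0 := by
    intro v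
    rw [← Finset.sum_filter, ← Finset.sum_mul]
    change X v * _ ≤ _
    rw [mul_max_of_nonneg _ _ (hX0 v), mul_zero]
    by_cases h0 : X v = 0
    · simp [h0]
    · simp only [ratio, if_neg h0, mul_sub, mul_one, mul_div_cancel₀ _ h0]
      exact le_rfl
  have h1 := Finset.sum_le_sum fun e (_ : e ∈ E) => hpt e
  rw [Finset.sum_add_distrib, Finset.sum_comm] at h1
  have h2 := Finset.sum_le_sum fun v (_ : v ∈ (Finset.univ : Finset V)) => hvert v
  linarith


end Matching

/-! ### Numerical bounds on the parameters -/

section Parameters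

variable {ε p : ℝ}

theorem one_le_log_one_div (hε0 : 0 < ε) (hε1 : ε ≤ Real.exp (-1)) : 1 ≤ Real.log (1 / ε) := by
  rw [one_div, Real.log_inv]
  have := Real.log_le_log hε0 hε1
  rw [Real.log_exp] at this
  linarith

theorem le_of_le_exp_neg_one (hε1 : ε ≤ Real.exp (-1)) : ε ≤ 0.37 := by
  have := Real.exp_neg_one_lt_d9
  linarith

theorem threshold_pos (hε0 : 0 < ε) (hε1 : ε ≤ Real.exp (-1)) (hp0 : 0 < p) :
    0 < threshold ε p := by
  have := one_le_log_one_div hε0 hε1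
  unfold threshold
  positivity

theorem threshold_div_le (hε0 : 0 < ε) (hε1 : ε ≤ Real.exp (-1)) (hp0 : 0 < p) :
    threshold ε p / p ≤ ε ^ 3 / 20 := by
  have hL := one_le_log_one_div hε0 hε1
  unfold threshold
  rw [div_div, div_le_div_iff₀ (by positivity) (by norm_num)]
  have : 0 ≤ ε ^ 3 * p * 20 := by positivity
  nlinarith

theorem one_le_log_one_div_mul (hε0 : 0 < ε) (hε1 : ε ≤ Real.exp (-1)) (hp0 : 0 < p)
    (hp1 : p ≤ 1) : 1 ≤ Real.log (1 / (ε * p)) :=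
  one_le_log_one_div (mul_pos hε0 hp0) ((mul_le_of_le_one_right hε0.le hp1).trans hε1)

theorem numRounds_lower (hε0 : 0 < ε) (hε1 : ε ≤ Real.exp (-1)) (hp0 : 0 < p) (hp1 : p ≤ 1) :
    2000 * Real.log (1 / ε) / (ε ^ 4 * p) ≤ numRounds ε p := by
  have hL := one_le_log_one_div hε0 hε1
  have hL' := one_le_log_one_div_mul hε0 hε1 hp0 hp1
  refine le_trans ?_ (Nat.le_ceil _)
  exact div_le_div_of_nonneg_right (le_mul_of_one_le_right (by positivity) hL') (by positivity)

theorem numRounds_pos (hε0 : 0 < ε) (hε1 : ε ≤ Real.exp (-1)) (hp0 : 0 < p) (hp1 : p ≤ 1) :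
    0 < numRounds ε p := by
  have hL := one_le_log_one_div hε0 hε1
  have := numRounds_lower hε0 hε1 hp0 hp1
  have h2 : 0 < 2000 * Real.log (1 / ε) / (ε ^ 4 * p) := by positivity
  exact_mod_cast h2.trans_le this

/-- A crucial edge is expected to be picked in at least `100 / ε` rounds. -/
theorem div_le_numRounds_mul_threshold (hε0 : 0 < ε) (hε1 : ε ≤ Real.exp (-1)) (hp0 : 0 < p)
    (hp1 : p ≤ 1) : 100 / ε ≤ numRounds ε p * threshold ε p := by
  have hL := one_le_log_one_div hε0 hε1
  have h := mul_le_mul_of_nonneg_right (numRounds_lower hε0 hε1 hp0 hp1)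
    (threshold_pos hε0 hε1 hp0).le
  refine le_trans (le_of_eq ?_) h
  unfold threshold
  field_simp
  norm_num

theorem two_div_numRounds_mul_le (hε0 : 0 < ε) (hε1 : ε ≤ Real.exp (-1)) (hp0 : 0 < p)
    (hp1 : p ≤ 1) : 2 / numRounds ε p / p ≤ ε ^ 3 / 1000 := by
  have hL := one_le_log_one_div hε0 hε1
  have hR : (0 : ℝ) < numRounds ε p := by exact_mod_cast numRounds_pos hε0 hε1 hp0 hp1
  have h := numRounds_lower hε0 hε1 hp0 hp1
  have hε := le_of_le_exp_neg_one hε1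
  rw [div_le_iff₀ (by positivity)] at h
  rw [div_div, div_le_div_iff₀ (by positivity) (by norm_num)]
  have h1 : (numRounds ε p : ℝ) * (ε ^ 4 * p) ≤ ε ^ 3 * (numRounds ε p * p) := by
    have : (numRounds ε p : ℝ) * (ε ^ 4 * p) = ε * (ε ^ 3 * (numRounds ε p * p)) := by ring
    rw [this]
    exact mul_le_of_le_one_left (by positivity) (by linarith)
  linarith

end Parameters

/-! ### The combined fractional matching -/

section Combined

variable {V : Type*} [DecidableEq V] {ε p : ℝ} {E : Finset (Sym2 V)}
  {M : Finset (Sym2 V) → Finset (Sym2 V)}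

/-- The room `min (1 - q^N_u) (1 - q^N_v)` that the non-crucial edges leave for the crucial edge
`{u, v}`. -/
noncomputable def residual (ε p : ℝ) (E : Finset (Sym2 V))
    (M : Finset (Sym2 V) → Finset (Sym2 V)) (e : Sym2 V) : ℝ :=
  Sym2.lift ⟨fun u v =>
    min (1 - nonCrucialWeight ε p E M u) (1 - nonCrucialWeight ε p E M v),
    fun _ _ => min_comm _ _⟩ e

theorem residual_le {e : Sym2 V} {v : V} (hv : v ∈ e) :
    residual ε p E M e ≤ 1 - nonCrucialWeight ε p E M v := by
  obtain ⟨w, rfl⟩ := hv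
  exact min_le_left _ _

theorem exists_residual_eq (e : Sym2 V) :
    ∃ v ∈ e, residual ε p E M e = 1 - nonCrucialWeight ε p E M v := by
  induction e with
  | _ a b =>
    rcases min_choice (1 - nonCrucialWeight ε p E M a) (1 - nonCrucialWeight ε p E M b) with h | h
    · exact ⟨a, by simp, h⟩
    · exact ⟨b, by simp, h⟩

theorem residual_nonneg (hM : IsMaxMatchingRule E M) (hp0 : 0 ≤ p) (hp1 : p ≤ 1) (e : Sym2 V) :
    0 ≤ residual ε p E M e := by
  obtain ⟨v, -, hv⟩ := exists_residual_eq (ε := ε) (p := p) (E := E) (M := M) e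
  rw [hv]
  linarith [nonCrucialWeight_le_one (ε := ε) hM hp0 hp1 v]

theorem residual_le_one (hp0 : 0 ≤ p) (hp1 : p ≤ 1) (e : Sym2 V) :
    residual ε p E M e ≤ 1 := by
  obtain ⟨v, -, hv⟩ := exists_residual_eq (ε := ε) (p := p) (E := E) (M := M) e
  rw [hv]
  linarith [nonCrucialWeight_nonneg (ε := ε) (E := E) (M := M) hp0 hp1 v]

theorem fracC_eq (μ : Finset (Sym2 V)) (e : Sym2 V) :
    fracC ε p E M μ e = if e ∈ μ then (1 - ε) * residual ε p E M e else 0 := rfl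

theorem fracC_nonneg (hM : IsMaxMatchingRule E M) (hp0 : 0 ≤ p) (hp1 : p ≤ 1) (hε : ε ≤ 1)
    (μ : Finset (Sym2 V)) (e : Sym2 V) : 0 ≤ fracC ε p E M μ e := by
  rw [fracC_eq]
  split_ifs
  · exact mul_nonneg (by linarith) (residual_nonneg hM hp0 hp1 e)
  · exact le_rfl

theorem sum_fracC_incident_le (hM : IsMaxMatchingRule E M) (hp0 : 0 ≤ p) (hp1 : p ≤ 1)
    (hε : ε ≤ 1) {μ : Finset (Sym2 V)} (hμ : IsEdgeMatching μ) (F : Finset (Sym2 V)) (v : V) :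
    ∑ e ∈ F with v ∈ e, fracC ε p E M μ e ≤ (1 - ε) * (1 - nonCrucialWeight ε p E M v) := by
  have ha := nonCrucialWeight_le_one (ε := ε) hM hp0 hp1 v
  have hB : 0 ≤ (1 - ε) * (1 - nonCrucialWeight ε p E M v) :=
    mul_nonneg (by linarith) (by linarith)
  have h1 : ∑ e ∈ F with v ∈ e, fracC ε p E M μ e ≤
      ∑ e ∈ F with v ∈ e,
        (if e ∈ μ then (1 - ε) * (1 - nonCrucialWeight ε p E M v) else 0) := by
    refine Finset.sum_le_sum fun e he => ?_
    rw [fracC_eq]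
    split_ifs
    · exact mul_le_mul_of_nonneg_left (residual_le (Finset.mem_filter.1 he).2) (by linarith)
    · exact le_rfl
  refine h1.trans ?_
  rw [← Finset.sum_filter, Finset.sum_const, nsmul_eq_mul]
  refine mul_le_of_le_one_left hB ?_
  have h : (F.filter (fun e => v ∈ e)).filter (· ∈ μ) ⊆ μ.filter (fun e => v ∈ e) := by
    intro e he
    simp only [Finset.mem_filter] at he ⊢
    exact ⟨he.2, he.1.2⟩
  exact_mod_cast (Finset.card_le_card h).trans (hμ.card_filter_mem_le_one v)

variable [Fintype V] {R : ℕ} {𝓔 : Fin R → Finset (Sym2 V)} {A μ : Finset (Sym2 V)}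

theorem frac_eq_add (hμ : μ ⊆ crucial ε p E M) (e : Sym2 V) :
    frac ε p E M 𝓔 A μ e = fracN ε p E M 𝓔 A e + fracC ε p E M μ e := by
  unfold frac
  split_ifs with hN hC
  · have : e ∉ μ := fun h => by
      have h1 := (Finset.mem_filter.1 (hμ h)).2
      have h2 := (Finset.mem_filter.1 hN).2
      linarith
    rw [fracC_eq, if_neg this, add_zero]
  · rw [fracN_eq_zero (fun h => hN (Finset.mem_inter.1 h).2), zero_add]
  · rw [fracN_eq_zero (fun h => hN (Finset.mem_inter.1 h).2), fracC_eq,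
      if_neg fun h => hC (hμ h), zero_add]

/-- At a vertex with non-crucial weight `a` the non-crucial edges take at most `max a ε` and the
crucial ones at most `(1 - ε) (1 - a)`, together at most `1`. -/
theorem isFractionalMatching_frac (hM : IsMaxMatchingRule E M) (hε0 : 0 < ε)
    (hε1 : ε ≤ Real.exp (-1)) (hp0 : 0 < p) (hp1 : p ≤ 1) (h𝓔 : ∀ r, 𝓔 r ⊆ E)
    (hμ : μ ⊆ querySet M 𝓔 ∩ crucial ε p E M ∩ A) (hμm : IsEdgeMatching μ) :
    IsFractionalMatching (querySet M 𝓔 ∩ A) (frac ε p E M 𝓔 A μ) := by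
  have hτ := (threshold_pos hε0 hε1 hp0).le
  have hε := le_of_le_exp_neg_one hε1
  have hε' : ε ≤ 1 := by linarith
  have hμC : μ ⊆ crucial ε p E M := fun e he =>
    (Finset.mem_inter.1 (Finset.mem_inter.1 (hμ he)).1).2
  simp only [IsFractionalMatching, frac_eq_add hμC]
  refine ⟨fun e => ?_, fun e he => ?_, fun v => ?_⟩
  · exact add_nonneg (fracN_nonneg hε0.le hτ hp0.le e) (fracC_nonneg hM hp0.le hp1 hε' μ e)
  · rw [fracN_eq_zero (fun h => he (Finset.mem_inter.1 h).1), fracC_eq, if_neg, add_zero]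
    intro h
    have := hμ h
    simp only [Finset.mem_inter] at this he
    exact he ⟨this.1.1, this.2⟩
  · rw [Finset.sum_add_distrib]
    have hsub : querySet M 𝓔 ∩ A ⊆ E :=
      Finset.inter_subset_left.trans (querySet_subset hM h𝓔)
    have h1 : ∑ e ∈ querySet M 𝓔 ∩ A with v ∈ e, fracN ε p E M 𝓔 A e ≤
        max (nonCrucialWeight ε p E M v) ε :=
      (Finset.sum_le_sum_of_subset_of_nonneg (Finset.filter_subset_filter _ hsub)
        fun e _ _ => fracN_nonneg hε0.le hτ hp0.le e).trans
        (sum_fracN_incident_le hε0.le hτ hp0.le v)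
    have h2 := sum_fracC_incident_le hM hp0.le hp1 hε' hμm (querySet M 𝓔 ∩ A) v
    have ha := nonCrucialWeight_le_one (ε := ε) hM hp0.le hp1 v
    have ha0 := nonCrucialWeight_nonneg (ε := ε) (E := E) (M := M) hp0.le hp1 v
    have h3 : max (nonCrucialWeight ε p E M v) ε ≤
        1 - (1 - ε) * (1 - nonCrucialWeight ε p E M v) := by
      refine max_le ?_ ?_ <;> nlinarith
    linarith

/-- The odd set constraints hold up to the factor `1 + ε² / 4`. In a small odd set the non-crucial
edges are so light that the factor `1 - ε` on the crucial matching pays for them; in a large one the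
vertex constraints suffice. -/
theorem sum_frac_odd_le (hM : IsMaxMatchingRule E M) (hE : ∀ e ∈ E, ¬ e.IsDiag) (hε0 : 0 < ε)
    (hε1 : ε ≤ Real.exp (-1)) (hp0 : 0 < p) (hp1 : p ≤ 1) (h𝓔 : ∀ r, 𝓔 r ⊆ E)
    (hμ : μ ⊆ querySet M 𝓔 ∩ crucial ε p E M ∩ A) (hμm : IsEdgeMatching μ)
    (W : Finset V) (hW : Odd W.card) :
    ∑ e ∈ querySet M 𝓔 ∩ A with (∀ v ∈ e, v ∈ W), frac ε p E M 𝓔 A μ e ≤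
      (1 + ε ^ 2 / 4) * (((W.card : ℝ) - 1) / 2) := by
  have hτ := (threshold_pos hε0 hε1 hp0).le
  have hε := le_of_le_exp_neg_one hε1
  have hε' : ε ≤ 1 := by linarith
  have hμC : μ ⊆ crucial ε p E M := fun e he =>
    (Finset.mem_inter.1 (Finset.mem_inter.1 (hμ he)).1).2
  have hsub : querySet M 𝓔 ∩ A ⊆ E :=
    Finset.inter_subset_left.trans (querySet_subset hM h𝓔)
  have hdiag : ∀ e ∈ querySet M 𝓔 ∩ A, ¬ e.IsDiag := fun e he => hE e (hsub he)
  have hx := isFractionalMatching_frac hM hε0 hε1 hp0 hp1 h𝓔 hμ hμm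
  obtain ⟨k, hk⟩ := hW
  have hkR : (W.card : ℝ) = 2 * k + 1 := by exact_mod_cast hk
  rw [hkR]
  have hk0 : (0 : ℝ) ≤ k := Nat.cast_nonneg k
  rcases Nat.eq_zero_or_pos k with rfl | hkpos
  · obtain ⟨w, rfl⟩ := Finset.card_eq_one.1 (by simpa using hk)
    rw [Finset.filter_eq_empty_iff.2]
    · simp
    · intro e he h
      refine hdiag e he ?_
      induction e with
      | _ a b =>
        have ha : a = w := by simpa using h a (by simp)
        have hb : b = w := by simpa using h b (by simp)
        rw [Sym2.mk_isDiag_iff, ha, hb]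
  have hk1 : (1 : ℝ) ≤ k := by exact_mod_cast hkpos
  -- around `2 k + 1 = 5 / ε²` both bounds work: above, `1 / (2 k) ≤ ε² / 4`; below, the at most
  -- `(2 k + 1) (k + 1)` pairs inside `W`, of value at most `ε³ / 10` each, weigh at most `k ε`
  by_cases hbig : 5 < (2 * (k : ℝ) + 1) * ε ^ 2
  · refine (sum_inside_le_half _ _ hx hdiag W).trans ?_
    rw [hkR]
    have : ε ^ 2 ≤ 1 := by nlinarith
    nlinarith
  · push Not at hbig
    have hN : ∑ e ∈ querySet M 𝓔 ∩ A with (∀ v ∈ e, v ∈ W), fracN ε p E M 𝓔 A e ≤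
        ((2 * k + 1) * (k + 1)) * (ε ^ 3 / 10) := by
      have hc : ((querySet M 𝓔 ∩ A).filter (fun e => ∀ v ∈ e, v ∈ W)).card ≤
          (2 * k + 1) * (k + 1) := by
        have h1 : (querySet M 𝓔 ∩ A).filter (fun e => ∀ v ∈ e, v ∈ W) ⊆ W.sym2 := by
          intro e he
          exact Finset.mem_sym2_iff.2 (Finset.mem_filter.1 he).2
        refine (Finset.card_le_card h1).trans ?_
        rw [Finset.card_sym2, hk, Nat.choose_two_right]
        refine Nat.div_le_of_le_mul (le_of_eq ?_)
        simp only [Nat.add_sub_cancel]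
        ring
      have hle : ∀ e, fracN ε p E M 𝓔 A e ≤ ε ^ 3 / 10 := fun e => by
        have h1 := fracN_le (E := E) (M := M) (𝓔 := 𝓔) (A := A) hτ hp0.le e
        have h2 := threshold_div_le hε0 hε1 hp0
        rw [mul_div_assoc] at h1
        linarith
      refine (Finset.sum_le_card_nsmul _ _ _ fun e _ => hle e).trans ?_
      rw [nsmul_eq_mul]
      have : (((querySet M 𝓔 ∩ A).filter (fun e => ∀ v ∈ e, v ∈ W)).card : ℝ) ≤
          (2 * k + 1) * (k + 1) := by exact_mod_cast hc
      gcongr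
    have hC : ∑ e ∈ querySet M 𝓔 ∩ A with (∀ v ∈ e, v ∈ W), fracC ε p E M μ e ≤ k * (1 - ε) := by
      have hind : IsFractionalMatching μ (fun e => if e ∈ μ then 1 else 0) := by
        refine ⟨fun e => by beta_reduce; split_ifs <;> norm_num, fun e he => if_neg he, fun v => ?_⟩
        rw [Finset.sum_boole]
        exact_mod_cast (Finset.card_le_card (Finset.filter_subset _ _)).trans
          (hμm.card_filter_mem_le_one v)
      have hμE : ∀ e ∈ μ, ¬ e.IsDiag := fun e he =>
        hE e (Finset.mem_filter.1 (hμC he)).1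
      have h1 := sum_inside_le_half _ _ hind hμE W
      rw [← Finset.sum_filter, Finset.sum_const, nsmul_eq_mul, mul_one, hkR] at h1
      set μW := (μ.filter (fun e => ∀ v ∈ e, v ∈ W)).filter (· ∈ μ) with hμW
      have h2 : μW.card ≤ k := by
        have : ((2 * μW.card : ℕ) : ℝ) < (2 * k + 2 : ℕ) := by push_cast; linarith
        have := Nat.cast_lt.1 this
        omega
      have h3 : ∑ e ∈ querySet M 𝓔 ∩ A with (∀ v ∈ e, v ∈ W), fracC ε p E M μ e ≤
          ∑ e ∈ μW, (1 - ε) := by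
        simp_rw [fracC_eq]
        rw [← Finset.sum_filter]
        refine (Finset.sum_le_sum fun e _ => mul_le_of_le_one_right (by linarith)
          (residual_le_one hp0.le hp1 e)).trans ?_
        refine Finset.sum_le_sum_of_subset_of_nonneg ?_ fun _ _ _ => by linarith
        intro e he
        simp only [hμW, Finset.mem_filter] at he ⊢
        exact ⟨⟨he.2, he.1.2⟩, he.2⟩
      refine h3.trans ?_
      rw [Finset.sum_const, nsmul_eq_mul]
      have : (μW.card : ℝ) ≤ k := by exact_mod_cast h2
      exact mul_le_mul_of_nonneg_right this (by linarith)
    simp only [frac_eq_add hμC, Finset.sum_add_distrib]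
    have h4 : ((2 * (k : ℝ) + 1) * (k + 1)) * (ε ^ 3 / 10) ≤ k * ε := by
      have h5 : ((2 * (k : ℝ) + 1) * (k + 1)) * (ε ^ 3 / 10) =
          ((2 * (k : ℝ) + 1) * ε ^ 2) * ((k + 1) * ε / 10) := by ring
      rw [h5]
      have h6 : 0 ≤ ((k : ℝ) + 1) * ε / 10 := by positivity
      refine (mul_le_mul_of_nonneg_right hbig h6).trans ?_
      nlinarith
    have h7 : 0 ≤ ε ^ 2 / 4 * k := by positivity
    linarith

/-- Rounding: the size of the fractional matching exceeds that of a maximum matching of the realized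
queried edges by a factor of at most `1 + ε² / 4`. -/
theorem sum_frac_le_card (hM : IsMaxMatchingRule E M) (hE : ∀ e ∈ E, ¬ e.IsDiag) (hε0 : 0 < ε)
    (hε1 : ε ≤ Real.exp (-1)) (hp0 : 0 < p) (hp1 : p ≤ 1) (h𝓔 : ∀ r, 𝓔 r ⊆ E)
    (hμ : μ ⊆ querySet M 𝓔 ∩ crucial ε p E M ∩ A) (hμm : IsEdgeMatching μ) :
    ∑ e ∈ E, frac ε p E M 𝓔 A μ e ≤ (1 + ε ^ 2 / 4) * (M (querySet M 𝓔 ∩ A)).card := by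
  have hsub : querySet M 𝓔 ∩ A ⊆ E :=
    Finset.inter_subset_left.trans (querySet_subset hM h𝓔)
  have hx := isFractionalMatching_frac hM hε0 hε1 hp0 hp1 h𝓔 hμ hμm
  rw [← Finset.sum_subset hsub fun e _ he => hx.2.1 e he]
  exact fractionalMatching_sum_le_mul _ _ hx (fun e he => hE e (hsub he)) _
    (by nlinarith [sq_nonneg ε])
    (sum_frac_odd_le hM hE hε0 hε1 hp0 hp1 h𝓔 hμ hμm) _ (hM _ hsub).2.2

end Combined

section Expected

variable {V : Type*} [DecidableEq V] {ε p : ℝ} {E : Finset (Sym2 V)}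
  {M : Finset (Sym2 V) → Finset (Sym2 V)} {R : ℕ}

/-! ### Moments of the sampled fractions -/

theorem expectRounds_roundFraction (hR : 0 < R) (e : Sym2 V) :
    expectRounds p E R (fun 𝓔 => roundFraction M 𝓔 e) = matchProb p E M e := by
  simp_rw [roundFraction_eq_average]
  exact expectRounds_average p hR fun A => if e ∈ M A then 1 else 0

theorem expectRounds_roundFraction_sq_le (hR : 0 < R) (e : Sym2 V) :
    expectRounds p E R (fun 𝓔 => roundFraction M 𝓔 e ^ 2) ≤
      matchProb p E M e ^ 2 + matchProb p E M e / R := by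
  simp_rw [roundFraction_eq_average]
  refine (expectRounds_average_sq_le p hR fun A => if e ∈ M A then 1 else 0).trans (le_of_eq ?_)
  simp only [ite_pow, one_pow, zero_pow two_ne_zero]
  rfl

theorem sum_roundFraction_eq_average (D : Finset (Sym2 V)) (𝓔 : Fin R → Finset (Sym2 V)) :
    ∑ e ∈ D, roundFraction M 𝓔 e = (∑ r, ((D.filter (· ∈ M (𝓔 r))).card : ℝ)) / R := by
  simp_rw [roundFraction_eq_average]
  rw [← Finset.sum_div, Finset.sum_comm]
  simp_rw [Finset.sum_boole]

/-- The fraction of rounds in which an edge of `D` is picked at `v` is an average of independent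
indicators. -/
theorem expectRounds_sum_roundFraction_sq_le (hM : IsMaxMatchingRule E M) (hp0 : 0 ≤ p)
    (hp1 : p ≤ 1) (hR : 0 < R) {D : Finset (Sym2 V)} (v : V) (hv : ∀ e ∈ D, v ∈ e) :
    expectRounds p E R (fun 𝓔 => (∑ e ∈ D, roundFraction M 𝓔 e) ^ 2) ≤
      (∑ e ∈ D, matchProb p E M e) ^ 2 + (∑ e ∈ D, matchProb p E M e) / R := by
  simp_rw [sum_roundFraction_eq_average]
  refine (expectRounds_average_sq_le p hR fun A => ((D.filter (· ∈ M A)).card : ℝ)).trans ?_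
  rw [sum_matchProb]
  gcongr
  refine expect_mono hp0 hp1 fun A hA => ?_
  have h1 : (D.filter (· ∈ M A)).card ≤ 1 := by
    refine le_trans (Finset.card_le_card ?_) ((hM A hA).2.1.card_filter_mem_le_one v)
    intro e he
    rw [Finset.mem_filter] at he ⊢
    exact ⟨he.2, hv e he.1⟩
  have h2 : ((D.filter (· ∈ M A)).card : ℝ) ≤ 1 := by exact_mod_cast h1
  have h3 : (0 : ℝ) ≤ (D.filter (· ∈ M A)).card := Nat.cast_nonneg _
  nlinarith

theorem expect_indicator_mem_mul_mem (p : ℝ) {e f : Sym2 V} (he : e ∈ E) (hf : f ∈ E) :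
    expect p E (fun A => (if e ∈ A then 1 else 0) * (if f ∈ A then 1 else 0)) ≤
      p ^ 2 + if e = f then p else 0 := by
  split_ifs with h
  · subst h
    have : ∀ A : Finset (Sym2 V), (if e ∈ A then (1 : ℝ) else 0) * (if e ∈ A then 1 else 0) =
        if e ∈ A then 1 else 0 := fun A => by split_ifs <;> simp
    simp_rw [this]
    rw [expect_indicator_mem p he]
    nlinarith
  · have h1 := expect_indicator_subset (E := E) p (D := {e, f}) (by
      intro x hx
      rcases Finset.mem_insert.1 hx with rfl | hx
      · exact he
      · rwa [Finset.mem_singleton.1 hx])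
    rw [Finset.card_pair h] at h1
    rw [add_zero, ← h1]
    refine le_of_eq (expect_congr p fun A _ => ?_)
    by_cases h1 : e ∈ A <;> by_cases h2 : f ∈ A <;> simp [h1, h2, Finset.insert_subset_iff]

/-- Second moment of a weighted sum over the realized edges, normalised by `p`. -/
theorem expect_sum_realized_sq_le (hp0 : 0 < p) {D : Finset (Sym2 V)} (hD : D ⊆ E)
    (f : Sym2 V → ℝ) (hf : ∀ e, 0 ≤ f e) :
    expect p E (fun A => (∑ e ∈ D, (if e ∈ A then f e / p else 0)) ^ 2) ≤
      (∑ e ∈ D, f e) ^ 2 + (∑ e ∈ D, f e ^ 2) / p := by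
  have h1 : ∀ A : Finset (Sym2 V), (∑ e ∈ D, (if e ∈ A then f e / p else 0)) ^ 2 =
      ∑ e ∈ D, ∑ g ∈ D, (f e / p * (f g / p)) *
        ((if e ∈ A then 1 else 0) * (if g ∈ A then 1 else 0)) := by
    intro A
    rw [sq, Finset.sum_mul_sum]
    refine Finset.sum_congr rfl fun e _ => Finset.sum_congr rfl fun g _ => ?_
    by_cases h1 : e ∈ A <;> by_cases h2 : g ∈ A <;> simp [h1, h2]
  simp_rw [h1]
  rw [expect_sum]
  simp_rw [expect_sum, expect_const_mul]
  refine (Finset.sum_le_sum fun e he => Finset.sum_le_sum fun g hg =>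
    mul_le_mul_of_nonneg_left (expect_indicator_mem_mul_mem p (hD he) (hD hg))
      (mul_nonneg (div_nonneg (hf e) hp0.le) (div_nonneg (hf g) hp0.le))).trans (le_of_eq ?_)
  simp only [mul_add, Finset.sum_add_distrib, mul_ite, mul_zero, Finset.sum_ite_eq]
  congr 1
  · rw [sq (∑ e ∈ D, f e), Finset.sum_mul_sum]
    refine Finset.sum_congr rfl fun e _ => Finset.sum_congr rfl fun g _ => ?_
    field_simp
  · rw [Finset.sum_div]
    refine Finset.sum_congr rfl fun e he => ?_
    rw [if_pos he]
    field_simp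

theorem expect_sum_realized (hp0 : 0 < p) {D : Finset (Sym2 V)} (hD : D ⊆ E) (f : Sym2 V → ℝ) :
    expect p E (fun A => ∑ e ∈ D, (if e ∈ A then f e / p else 0)) = ∑ e ∈ D, f e := by
  rw [expect_sum]
  refine Finset.sum_congr rfl fun e he => ?_
  have : ∀ A : Finset (Sym2 V), (if e ∈ A then f e / p else 0) =
      (f e / p) * (if e ∈ A then 1 else 0) := fun A => by split_ifs <;> simp
  simp_rw [this]
  rw [expect_const_mul, expect_indicator_mem p (hD he)]
  field_simp

/-- Variance bound for the untruncated value at a vertex: the mean is the non-crucial weight `a`,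
the variance at most `a (τ + 2 / R) / p`. -/
theorem variance_untruncated_le (hM : IsMaxMatchingRule E M) (hp0 : 0 < p) (hp1 : p ≤ 1)
    (hR : 0 < R) (v : V) :
    expectRounds p E R (fun 𝓔 => expect p E (fun A =>
      (∑ e ∈ nonCrucial ε p E M with v ∈ e, (if e ∈ A then roundFraction M 𝓔 e / p else 0) -
        nonCrucialWeight ε p E M v) ^ 2)) ≤
      nonCrucialWeight ε p E M v * (threshold ε p / p + 2 / R / p) := by
  have hR' : (0 : ℝ) < R := by exact_mod_cast hR
  set D := (nonCrucial ε p E M).filter (fun e => v ∈ e) with hDdef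
  have hD : D ⊆ E := (Finset.filter_subset _ _).trans (Finset.filter_subset _ _)
  set a := nonCrucialWeight ε p E M v with ha
  have hasum : ∑ e ∈ D, matchProb p E M e = a := rfl
  have ha0 : 0 ≤ a := nonCrucialWeight_nonneg hp0.le hp1 v
  have hq0 : ∀ e, 0 ≤ matchProb p E M e := fun e => matchProb_nonneg hp0.le hp1 e
  have h1 : ∀ 𝓔 : Fin R → Finset (Sym2 V), expect p E (fun A =>
      (∑ e ∈ D, (if e ∈ A then roundFraction M 𝓔 e / p else 0) - a) ^ 2) ≤
      ((∑ e ∈ D, roundFraction M 𝓔 e) ^ 2 + p⁻¹ * ∑ e ∈ D, roundFraction M 𝓔 e ^ 2) +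
        ((-2 * a) * ∑ e ∈ D, roundFraction M 𝓔 e + a ^ 2) := by
    intro 𝓔
    have : ∀ A : Finset (Sym2 V),
        (∑ e ∈ D, (if e ∈ A then roundFraction M 𝓔 e / p else 0) - a) ^ 2 =
        (∑ e ∈ D, (if e ∈ A then roundFraction M 𝓔 e / p else 0)) ^ 2 +
          ((-2 * a) * ∑ e ∈ D, (if e ∈ A then roundFraction M 𝓔 e / p else 0) + a ^ 2) := by
      intro A; ring
    simp_rw [this]
    rw [expect_add, expect_add, expect_const_mul, expect_const, expect_sum_realized hp0 hD]
    have := expect_sum_realized_sq_le hp0 hD (fun e => roundFraction M 𝓔 e)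
      (fun e => roundFraction_nonneg e)
    rw [div_eq_inv_mul] at this
    linarith
  refine (expectRounds_mono hp0.le hp1 fun 𝓔 _ => h1 𝓔).trans ?_
  rw [expectRounds_add, expectRounds_add, expectRounds_add, expectRounds_const_mul,
    expectRounds_const_mul, expectRounds_const, expectRounds_sum, expectRounds_sum]
  simp_rw [expectRounds_roundFraction hR]
  have h2 := expectRounds_sum_roundFraction_sq_le (D := D) hM hp0.le hp1 hR v
    (fun e he => (Finset.mem_filter.1 he).2)
  rw [hasum] at h2 ⊢
  have h3 : ∑ e ∈ D, expectRounds p E R (fun 𝓔 => roundFraction M 𝓔 e ^ 2) ≤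
      a * (threshold ε p + 1 / R) := by
    rw [← hasum, Finset.sum_mul]
    refine Finset.sum_le_sum fun e he => (expectRounds_roundFraction_sq_le hR e).trans ?_
    have hlt := (Finset.mem_filter.1 (Finset.mem_filter.1 he).1).2
    rw [mul_add, mul_one_div, sq]
    have := mul_le_mul_of_nonneg_left hlt.le (hq0 e)
    linarith
  have h4 : p⁻¹ * ∑ e ∈ D, expectRounds p E R (fun 𝓔 => roundFraction M 𝓔 e ^ 2) ≤
      p⁻¹ * (a * (threshold ε p + 1 / R)) :=
    mul_le_mul_of_nonneg_left h3 (by positivity)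
  have h5 : a / R ≤ a * (1 / R / p) := by
    rw [← mul_one_div]
    refine mul_le_mul_of_nonneg_left ?_ ha0
    rw [le_div_iff₀ hp0]
    exact mul_le_of_le_one_right (by positivity) hp1
  have h6 : a * (threshold ε p / p + 2 / R / p) =
      p⁻¹ * (a * (threshold ε p + 1 / R)) + a * (1 / R / p) := by
    field_simp; ring
  rw [h6]
  nlinarith

/-! ### Expected size on the non-crucial edges -/

/-- `E max (X - b) 0` is bounded by a variance: `x - b ≤ t + (x - a)² / (4 (b - a + t))`, here with
`b = max a ε` and `t = ε a / 8`, for which `b - a + t ≥ ε² / 8`. -/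
theorem excess_le {a ε x : ℝ} (hε0 : 0 < ε) (hε1 : ε ≤ 1) (ha : 0 ≤ a) :
    max (x - max a ε) 0 ≤ ε / 8 * a + 2 / ε ^ 2 * (x - a) ^ 2 := by
  refine max_le ?_ (by positivity)
  set b := max a ε with hb
  have hba : a ≤ b := le_max_left _ _
  have hbε : ε ≤ b := le_max_right _ _
  set c := b - a + ε / 8 * a with hc
  have hcl : ε ^ 2 / 8 ≤ c := by
    rcases le_total a ε with h | h
    · rw [hb, max_eq_right h] at hc
      nlinarith
    · nlinarith
  have hx : x - b ≤ ε / 8 * a + ((x - a) - c) := by rw [hc]; linarith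
  have h2 : (x - a) - c ≤ 2 / ε ^ 2 * (x - a) ^ 2 := by
    have h3 : 2 / ε ^ 2 * (x - a) ^ 2 + ε ^ 2 / 8 - (x - a) =
        2 / ε ^ 2 * ((x - a) - ε ^ 2 / 4) ^ 2 := by
      field_simp; ring
    have : 0 ≤ 2 / ε ^ 2 * ((x - a) - ε ^ 2 / 4) ^ 2 := by positivity
    linarith
  linarith

theorem unscaledNVertex_le (hτ : 0 ≤ threshold ε p) (hp0 : 0 ≤ p)
    (𝓔 : Fin R → Finset (Sym2 V)) (A : Finset (Sym2 V)) (v : V) :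
    unscaledNVertex ε p E M 𝓔 A v ≤
      ∑ e ∈ nonCrucial ε p E M with v ∈ e, (if e ∈ A then roundFraction M 𝓔 e / p else 0) := by
  have hsub : (nonCrucial ε p E M).filter (fun e => v ∈ e) ⊆ E.filter (fun e => v ∈ e) :=
    Finset.filter_subset_filter _ (Finset.filter_subset _ _)
  rw [unscaledNVertex, ← Finset.sum_subset hsub]
  · refine Finset.sum_le_sum fun e he => ?_
    rw [unscaledN_eq hτ hp0 (Finset.mem_filter.1 he).1]
    split_ifs
    · exact min_le_left _ _
    · exact le_rfl
  · intro e he hne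
    refine unscaledN_eq_zero fun h => hne ?_
    exact Finset.mem_filter.2 ⟨(Finset.mem_inter.1 h).2, (Finset.mem_filter.1 he).2⟩

theorem expected_excess_le (hM : IsMaxMatchingRule E M) (hε0 : 0 < ε) (hε1 : ε ≤ 1)
    (hτ : 0 ≤ threshold ε p) (hp0 : 0 < p) (hp1 : p ≤ 1)
    (hR : 0 < R) (v : V) :
    expectRounds p E R (fun 𝓔 => expect p E (fun A => max (unscaledNVertex ε p E M 𝓔 A v -
      max (nonCrucialWeight ε p E M v) ε) 0)) ≤
      nonCrucialWeight ε p E M v * (ε / 8 + 2 / ε ^ 2 * (threshold ε p / p + 2 / R / p)) := by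
  have ha0 : 0 ≤ nonCrucialWeight ε p E M v := nonCrucialWeight_nonneg hp0.le hp1 v
  refine (expectRounds_mono hp0.le hp1 fun 𝓔 _ => expect_mono hp0.le hp1 fun A _ =>
    (max_le_max_right 0 (sub_le_sub_right (unscaledNVertex_le hτ hp0.le 𝓔 A v) _)).trans
      (excess_le hε0 hε1 ha0)).trans ?_
  simp_rw [expect_add, expect_const_mul, expect_const]
  rw [expectRounds_add, expectRounds_const, expectRounds_const_mul]
  have := mul_le_mul_of_nonneg_left (variance_untruncated_le (ε := ε) hM hp0 hp1 hR v)
    (show 0 ≤ 2 / ε ^ 2 by positivity)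
  linarith

/-- Truncating at `2 τ` costs little, because `q_e < τ` and `f_e` has variance at most `q_e / R`. -/
theorem expected_unscaledN_ge (hτ : 0 < threshold ε p) (hp0 : 0 < p)
    (hp1 : p ≤ 1) (hR : 0 < R) {e : Sym2 V} (he : e ∈ nonCrucial ε p E M) :
    matchProb p E M e * (1 - 1 / (4 * (R * threshold ε p))) ≤
      expectRounds p E R (fun 𝓔 => expect p E (fun A => unscaledN ε p E M 𝓔 A e)) := by
  have hR' : (0 : ℝ) < R := by exact_mod_cast hR
  have heE : e ∈ E := (Finset.mem_filter.1 he).1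
  have hlt : matchProb p E M e < threshold ε p := (Finset.mem_filter.1 he).2
  set q := matchProb p E M e with hq
  set τ := threshold ε p with hτd
  have h1 : ∀ 𝓔 : Fin R → Finset (Sym2 V), expect p E (fun A => unscaledN ε p E M 𝓔 A e) =
      min (roundFraction M 𝓔 e) (2 * τ) := by
    intro 𝓔
    have : ∀ A, unscaledN ε p E M 𝓔 A e =
        (min (roundFraction M 𝓔 e) (2 * τ) / p) * (if e ∈ A then 1 else 0) := by
      intro A
      rw [unscaledN_eq hτ.le hp0.le he, min_div_div_right hp0.le]
      split_ifs <;> simp [hτd]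
    simp_rw [this]
    rw [expect_const_mul, expect_indicator_mem p heE]
    field_simp
  simp_rw [h1]
  have h2 : ∀ 𝓔 : Fin R → Finset (Sym2 V),
      (1 + q / (2 * τ)) * roundFraction M 𝓔 e +
        ((-(1 / (4 * τ))) * roundFraction M 𝓔 e ^ 2 + (-(q ^ 2 / (4 * τ)))) ≤
      min (roundFraction M 𝓔 e) (2 * τ) := by
    intro 𝓔
    set f := roundFraction M 𝓔 e
    have h3 : (1 + q / (2 * τ)) * f + ((-(1 / (4 * τ))) * f ^ 2 + (-(q ^ 2 / (4 * τ)))) =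
        f - (f - q) ^ 2 / (4 * τ) := by
      field_simp; ring
    rw [h3]
    refine le_min ?_ ?_
    · have : 0 ≤ (f - q) ^ 2 / (4 * τ) := by positivity
      linarith
    · have h4 : (f - q) ^ 2 / (4 * τ) - (f - q - τ) = (f - q - 2 * τ) ^ 2 / (4 * τ) := by
        field_simp; ring
      have : 0 ≤ (f - q - 2 * τ) ^ 2 / (4 * τ) := by positivity
      linarith
  refine le_trans ?_ (expectRounds_mono hp0.le hp1 fun 𝓔 _ => h2 𝓔)
  rw [expectRounds_add, expectRounds_add, expectRounds_const_mul, expectRounds_const_mul,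
    expectRounds_const, expectRounds_roundFraction hR]
  have h5 := mul_le_mul_of_nonneg_left
    (expectRounds_roundFraction_sq_le (p := p) (E := E) (M := M) hR e)
    (show 0 ≤ 1 / (4 * τ) by positivity)
  have h6 : q * (1 - 1 / (4 * (R * τ))) = (1 + q / (2 * τ)) * q - 1 / (4 * τ) * (q ^ 2 + q / R) -
      q ^ 2 / (4 * τ) := by
    field_simp; ring
  rw [h6]
  linarith

theorem sum_nonCrucialWeight_le [Fintype V] (hp0 : 0 ≤ p) (hp1 : p ≤ 1) :
    ∑ v, nonCrucialWeight ε p E M v ≤ 2 * ∑ e ∈ nonCrucial ε p E M, matchProb p E M e := by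
  simp only [nonCrucialWeight, Finset.sum_filter]
  rw [Finset.sum_comm, Finset.mul_sum]
  refine Finset.sum_le_sum fun e _ => ?_
  rw [← Finset.sum_filter, Finset.sum_const, nsmul_eq_mul]
  have : ((Finset.univ.filter (fun v => v ∈ e)).card : ℝ) ≤ 2 := by
    exact_mod_cast card_filter_mem_sym2_le e
  exact mul_le_mul_of_nonneg_right this (matchProb_nonneg hp0 hp1 e)

theorem expected_sum_fracN_ge [Fintype V] (hM : IsMaxMatchingRule E M) (hε0 : 0 < ε)
    (hε1 : ε ≤ Real.exp (-1)) (hp0 : 0 < p) (hp1 : p ≤ 1) :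
    (1 - ε / 2) * ∑ e ∈ nonCrucial ε p E M, matchProb p E M e ≤
      expectRounds p E (numRounds ε p) (fun 𝓔 => expect p E (fun A =>
        ∑ e ∈ E, fracN ε p E M 𝓔 A e)) := by
  have hτ := threshold_pos hε0 hε1 hp0
  have hR := numRounds_pos hε0 hε1 hp0 hp1
  refine le_trans ?_ (expectRounds_mono hp0.le hp1 fun 𝓔 _ => expect_mono hp0.le hp1 fun A _ =>
    sum_unscaledN_sub_excess_le_sum_fracN hτ.le hp0.le)
  simp_rw [expect_sub, expect_sum]
  rw [expectRounds_sub, expectRounds_sum, expectRounds_sum]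
  set Q := ∑ e ∈ nonCrucial ε p E M, matchProb p E M e with hQ
  have hQ0 : 0 ≤ Q := Finset.sum_nonneg fun e _ => matchProb_nonneg hp0.le hp1 e
  set R := numRounds ε p with hRd
  have h1 : Q * (1 - 1 / (4 * (R * threshold ε p))) ≤ ∑ e ∈ E,
      expectRounds p E R (fun 𝓔 => expect p E (fun A => unscaledN ε p E M 𝓔 A e)) := by
    have hsub : nonCrucial ε p E M ⊆ E := Finset.filter_subset _ _
    rw [← Finset.sum_subset hsub, hQ, Finset.sum_mul]
    · exact Finset.sum_le_sum fun e he => expected_unscaledN_ge hτ hp0 hp1 hR he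
    · intro e _ he
      have : ∀ (𝓔 : Fin R → Finset (Sym2 V)) A, unscaledN ε p E M 𝓔 A e = 0 := fun 𝓔 A =>
        unscaledN_eq_zero fun h => he (Finset.mem_inter.1 h).2
      simp_rw [this]
      simp [expect_const, expectRounds_const]
  have h2 : ∑ v, expectRounds p E R (fun 𝓔 => expect p E (fun A =>
      max (unscaledNVertex ε p E M 𝓔 A v - max (nonCrucialWeight ε p E M v) ε) 0)) ≤
      (2 * Q) * (ε / 8 + 2 / ε ^ 2 * (threshold ε p / p + 2 / R / p)) := by
    refine (Finset.sum_le_sum fun v _ => expected_excess_le hM hε0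
      (by linarith [le_of_le_exp_neg_one hε1]) hτ.le hp0 hp1 hR v).trans ?_
    rw [← Finset.sum_mul]
    refine mul_le_mul_of_nonneg_right (sum_nonCrucialWeight_le hp0.le hp1) ?_
    positivity
  have h3 : 1 / (4 * (R * threshold ε p)) ≤ ε / 400 := by
    have h := div_le_numRounds_mul_threshold hε0 hε1 hp0 hp1
    have h4 : 400 / ε ≤ 4 * (R * threshold ε p) := by
      have : 400 / ε = 4 * (100 / ε) := by ring
      rw [this]; linarith
    have := one_div_le_one_div_of_le (by positivity) h4
    rwa [one_div_div] at this
  have h4 : 2 / ε ^ 2 * (threshold ε p / p + 2 / R / p) ≤ 0.102 * ε := by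
    have e1 := threshold_div_le hε0 hε1 hp0
    have e2 := two_div_numRounds_mul_le hε0 hε1 hp0 hp1
    have e3 : threshold ε p / p + 2 / R / p ≤ 0.051 * ε ^ 3 := by linarith
    refine (mul_le_mul_of_nonneg_left e3 (by positivity)).trans (le_of_eq ?_)
    field_simp; norm_num
  have h5 := mul_le_mul_of_nonneg_left h3 hQ0
  have h6 := mul_le_mul_of_nonneg_left h4 (show 0 ≤ 2 * Q by positivity)
  have h7 : 0 ≤ Q * ε := by positivity
  linarith

end Expected

section CrucialExpected

variable {V : Type*} [DecidableEq V] {ε p : ℝ} {E : Finset (Sym2 V)}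
  {M : Finset (Sym2 V) → Finset (Sym2 V)} {R : ℕ}

/-! ### The drawn crucial matching -/

theorem appearProb_nonneg (hp0 : 0 ≤ p) (hp1 : p ≤ 1) (T RC μ : Finset (Sym2 V)) :
    0 ≤ appearProb p E M T RC μ :=
  div_nonneg (expect_nonneg hp0 hp1 fun B _ => by split_ifs <;> norm_num)
    (expect_nonneg hp0 hp1 fun B _ => by split_ifs <;> norm_num)

/-- The joint probability that `M (E_p) ∩ T = μ` and `E_p ∩ T = RC` is the appearance probability
times the probability of the condition, also where the latter is zero. -/
theorem expect_mul_appearProb (hp0 : 0 ≤ p) (hp1 : p ≤ 1) (T RC μ : Finset (Sym2 V)) :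
    expect p E (fun B => if B ∩ T = RC then 1 else 0) * appearProb p E M T RC μ =
      expect p E (fun B => if M B ∩ T = μ ∧ B ∩ T = RC then 1 else 0) := by
  unfold appearProb
  by_cases h : expect p E (fun B => if B ∩ T = RC then 1 else 0) = 0
  · rw [h, zero_mul]
    refine le_antisymm (expect_nonneg hp0 hp1 fun B _ => by split_ifs <;> norm_num) ?_
    refine le_trans (expect_mono hp0 hp1 (G := fun B => if B ∩ T = RC then 1 else 0)
      fun B _ => ?_) h.le
    by_cases h1 : M B ∩ T = μ <;> by_cases h2 : B ∩ T = RC <;> simp [h1, h2]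
  · exact mul_div_cancel₀ _ h

theorem sum_appearProb_le_one (hp0 : 0 ≤ p) (hp1 : p ≤ 1) (T RC : Finset (Sym2 V)) :
    ∑ μ ∈ RC.powerset, appearProb p E M T RC μ ≤ 1 := by
  simp only [appearProb]
  rw [← Finset.sum_div, ← expect_sum]
  refine div_le_one_of_le₀ (expect_mono hp0 hp1 fun B _ => ?_)
    (expect_nonneg hp0 hp1 fun B _ => by split_ifs <;> norm_num)
  by_cases h : B ∩ T = RC
  · simp only [h, and_true, if_true, Finset.sum_ite_eq]
    split_ifs <;> norm_num
  · simp [h]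

/-- Averaged over the realization, the drawn matching has the law of `M (E_p) ∩ T`. -/
theorem expect_sum_appearProb (hM : IsMaxMatchingRule E M) (hp0 : 0 ≤ p) (hp1 : p ≤ 1)
    (T : Finset (Sym2 V)) (h : Finset (Sym2 V) → ℝ) :
    expect p E (fun A => ∑ μ ∈ (T ∩ A).powerset, appearProb p E M T (T ∩ A) μ * h μ) =
      expect p E (fun B => h (M B ∩ T)) := by
  have h1 : ∀ A : Finset (Sym2 V),
      ∑ μ ∈ (T ∩ A).powerset, appearProb p E M T (T ∩ A) μ * h μ =
      ∑ RC ∈ T.powerset, (∑ μ ∈ RC.powerset, appearProb p E M T RC μ * h μ) *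
        (if A ∩ T = RC then 1 else 0) := by
    intro A
    simp only [mul_ite, mul_one, mul_zero, Finset.sum_ite_eq]
    rw [if_pos (Finset.mem_powerset.2 Finset.inter_subset_right), Finset.inter_comm]
  have h2 : ∀ RC, (∑ μ ∈ RC.powerset, appearProb p E M T RC μ * h μ) *
      expect p E (fun A => if A ∩ T = RC then 1 else 0) =
      expect p E (fun B => ∑ μ ∈ RC.powerset,
        h μ * (if M B ∩ T = μ ∧ B ∩ T = RC then 1 else 0)) := by
    intro RC
    rw [expect_sum, Finset.sum_mul]
    refine Finset.sum_congr rfl fun μ _ => ?_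
    rw [expect_const_mul, ← expect_mul_appearProb hp0 hp1]
    ring
  simp_rw [h1]
  rw [expect_sum]
  simp_rw [expect_const_mul, h2]
  rw [← expect_sum]
  refine expect_congr p fun B hB => ?_
  have hsub : M B ∩ T ⊆ B ∩ T := Finset.inter_subset_inter_right (hM B hB).1
  rw [Finset.sum_eq_single (B ∩ T), Finset.sum_eq_single (M B ∩ T)]
  · simp
  · intro μ _ hμ
    simp [hμ.symm]
  · intro hn
    exact absurd (Finset.mem_powerset.2 hsub) hn
  · intro RC _ hRC
    simp [hRC.symm]
  · intro hn
    exact absurd (Finset.mem_powerset.2 Finset.inter_subset_right) hn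

/-- An edge is queried unless every round misses it. -/
theorem expectRounds_mem_querySet (e : Sym2 V) :
    expectRounds p E R (fun 𝓔 => if e ∈ querySet M 𝓔 then 1 else 0) =
      1 - (1 - matchProb p E M e) ^ R := by
  have h1 : ∀ 𝓔 : Fin R → Finset (Sym2 V), (if e ∈ querySet M 𝓔 then (1 : ℝ) else 0) =
      1 - ∏ r, (1 - if e ∈ M (𝓔 r) then 1 else 0) := by
    intro 𝓔
    by_cases h : e ∈ querySet M 𝓔
    · obtain ⟨r, -, hr⟩ := Finset.mem_biUnion.1 h
      rw [if_pos h, Finset.prod_eq_zero (Finset.mem_univ r) (by simp [hr]), sub_zero]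
    · rw [if_neg h, Finset.prod_eq_one, sub_self]
      intro r _
      rw [if_neg fun hr => h (Finset.mem_biUnion.2 ⟨r, Finset.mem_univ r, hr⟩), sub_zero]
  simp_rw [h1]
  rw [expectRounds_sub, expectRounds_const,
    expectRounds_prod p (fun _ A => 1 - if e ∈ M A then (1 : ℝ) else 0)]
  simp_rw [expect_sub, expect_const]
  simp [matchProb]

/-- Crucial edges are queried with high probability:
`(1 - q)^R ≤ exp (-R q) ≤ 1 / (1 + R q)`, and `R q` is at least `100 / ε`. -/
theorem crucial_queried_ge (hε0 : 0 < ε) (hε1 : ε ≤ Real.exp (-1)) (hp0 : 0 < p) (hp1 : p ≤ 1)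
    {e : Sym2 V} (he : e ∈ crucial ε p E M) :
    1 - ε / 100 ≤ expectRounds p E (numRounds ε p)
      (fun 𝓔 => if e ∈ querySet M 𝓔 then 1 else 0) := by
  rw [expectRounds_mem_querySet]
  set R := numRounds ε p
  set q := matchProb p E M e
  have hq1 : q ≤ 1 := matchProb_le_one hp0.le hp1 e
  have hτq : threshold ε p ≤ q := (Finset.mem_filter.1 he).2
  have hRq : 100 / ε ≤ R * q := (div_le_numRounds_mul_threshold hε0 hε1 hp0 hp1).trans
    (mul_le_mul_of_nonneg_left hτq (Nat.cast_nonneg _))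
  have h1 : (1 - q) ^ R ≤ Real.exp (-(R * q)) := by
    have := pow_le_pow_left₀ (sub_nonneg.2 hq1) (Real.one_sub_le_exp_neg q) R
    rwa [← Real.exp_nat_mul, mul_neg] at this
  have h2 : Real.exp (-(R * q)) ≤ ε / 100 := by
    rw [Real.exp_neg]
    have h3 : 100 / ε ≤ Real.exp (R * q) := by
      have := Real.add_one_le_exp (R * q)
      linarith
    have := inv_anti₀ (by positivity) h3
    rwa [inv_div] at this
  linarith

theorem expected_sum_fracC_ge (hM : IsMaxMatchingRule E M) (hε0 : 0 < ε)
    (hε1 : ε ≤ Real.exp (-1)) (hp0 : 0 < p) (hp1 : p ≤ 1) :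
    (1 - ε) * (1 - ε / 100) *
        ∑ e ∈ crucial ε p E M, matchProb p E M e * residual ε p E M e ≤
      expectRounds p E (numRounds ε p) (fun 𝓔 => expect p E (fun B =>
        ∑ e ∈ E, fracC ε p E M (M B ∩ (querySet M 𝓔 ∩ crucial ε p E M)) e)) := by
  have hε := le_of_le_exp_neg_one hε1
  have hsub : crucial ε p E M ⊆ E := Finset.filter_subset _ _
  have h1 : ∀ (𝓔 : Fin (numRounds ε p) → Finset (Sym2 V)) (B : Finset (Sym2 V)),
      ∑ e ∈ E, fracC ε p E M (M B ∩ (querySet M 𝓔 ∩ crucial ε p E M)) e =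
      ∑ e ∈ crucial ε p E M, ((1 - ε) * residual ε p E M e *
        (if e ∈ querySet M 𝓔 then 1 else 0)) * (if e ∈ M B then 1 else 0) := by
    intro 𝓔 B
    rw [← Finset.sum_subset hsub]
    · refine Finset.sum_congr rfl fun e he => ?_
      rw [fracC_eq]
      by_cases h2 : e ∈ querySet M 𝓔 <;> by_cases h3 : e ∈ M B <;> simp [h2, h3, he]
    · intro e _ he
      rw [fracC_eq, if_neg]
      intro h
      exact he (Finset.mem_inter.1 (Finset.mem_inter.1 h).2).2
  simp_rw [h1, expect_sum, expect_const_mul]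
  rw [expectRounds_sum, Finset.mul_sum]
  refine Finset.sum_le_sum fun e he => ?_
  change _ ≤ expectRounds p E (numRounds ε p) (fun 𝓔 => (1 - ε) * residual ε p E M e *
    (if e ∈ querySet M 𝓔 then 1 else 0) * matchProb p E M e)
  have h2 : ∀ 𝓔 : Fin (numRounds ε p) → Finset (Sym2 V), (1 - ε) * residual ε p E M e *
      (if e ∈ querySet M 𝓔 then 1 else 0) * matchProb p E M e =
      ((1 - ε) * residual ε p E M e * matchProb p E M e) *
        (if e ∈ querySet M 𝓔 then 1 else 0) := fun 𝓔 => by ring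
  simp_rw [h2]
  rw [expectRounds_const_mul]
  have h3 : 0 ≤ (1 - ε) * residual ε p E M e * matchProb p E M e :=
    mul_nonneg (mul_nonneg (by linarith) (residual_nonneg hM hp0.le hp1 e))
      (matchProb_nonneg hp0.le hp1 e)
  refine le_trans (le_of_eq ?_)
    (mul_le_mul_of_nonneg_left (crucial_queried_ge hε0 hε1 hp0 hp1 he) h3)
  ring

/-! ### The factor `4√2 - 5` -/

/-- The extremal inequality at one vertex with non-crucial weight `a` and charged crucial weight
`c`; it is tight at `c = √2 - 1`, `a = 2 - √2`. -/
theorem vertex_inequality {a c : ℝ} (ha : 0 ≤ a) (hc : 0 ≤ c) (hac : a + c ≤ 1) :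
    a * c ≤ (6 - 4 * √2) * (a / 2 + c) := by
  have hs : √2 * √2 = 2 := Real.mul_self_sqrt (by norm_num)
  have hs0 : 0 ≤ √2 := Real.sqrt_nonneg 2
  have hs1 : √2 ≤ 1.5 := by nlinarith
  have h0 : 0 ≤ 6 - 4 * √2 := by linarith
  have h1 : (6 - 4 * √2) * ((a / 2 + c) * (a + c)) ≤ (6 - 4 * √2) * (a / 2 + c) :=
    mul_le_mul_of_nonneg_left (mul_le_of_le_one_right (by positivity) hac) h0
  -- the homogeneous form is a multiple of `(a - √2 c)²`
  have h2 : (6 - 4 * √2) * ((a / 2 + c) * (a + c)) - a * c =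
      (3 - 2 * √2) * (a - √2 * c) ^ 2 := by
    linear_combination (-4 * a * c - (3 - 2 * √2) * c ^ 2) * hs
  have h3 : 0 ≤ (3 - 2 * √2) * (a - √2 * c) ^ 2 :=
    mul_nonneg (by linarith) (sq_nonneg _)
  linarith

/-- Charge every crucial edge to an endpoint of larger non-crucial weight, and sum the inequality at
one vertex. -/
theorem sum_residual_ge [Fintype V] (hM : IsMaxMatchingRule E M) (hp0 : 0 ≤ p) (hp1 : p ≤ 1) :
    (4 * √2 - 5) * opt p E M ≤ ∑ e ∈ nonCrucial ε p E M, matchProb p E M e +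
      ∑ e ∈ crucial ε p E M, matchProb p E M e * residual ε p E M e := by
  have hq0 : ∀ e, 0 ≤ matchProb p E M e := fun e => matchProb_nonneg hp0 hp1 e
  choose h hmem hres using
    fun e => exists_residual_eq (ε := ε) (p := p) (E := E) (M := M) e
  set a : V → ℝ := nonCrucialWeight ε p E M with ha
  let c : V → ℝ := fun v => ∑ e ∈ crucial ε p E M with h e = v, matchProb p E M e
  have hac : ∀ v, a v + c v ≤ 1 := fun v => by
    refine le_trans (add_le_add_right ?_ _) (nonCrucialWeight_add_sum_crucial_le_one hM hp0 hp1 v)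
    refine Finset.sum_le_sum_of_subset_of_nonneg (fun e he => ?_) fun e _ _ => hq0 e
    rw [Finset.mem_filter] at he ⊢
    exact ⟨he.1, he.2 ▸ hmem e⟩
  have hv := Finset.sum_le_sum fun v (_ : v ∈ (Finset.univ : Finset V)) =>
    vertex_inequality (nonCrucialWeight_nonneg (ε := ε) (E := E) (M := M) hp0 hp1 v)
      (Finset.sum_nonneg fun e _ => hq0 e) (hac v)
  have hcsum : ∑ v, c v = ∑ e ∈ crucial ε p E M, matchProb p E M e :=
    Finset.sum_fiberwise _ _ _
  have hacsum : ∑ v, a v * c v = ∑ e ∈ crucial ε p E M, a (h e) * matchProb p E M e := by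
    rw [← Finset.sum_fiberwise (crucial ε p E M) h]
    refine Finset.sum_congr rfl fun v _ => ?_
    rw [Finset.mul_sum]
    exact Finset.sum_congr rfl fun e he => by rw [(Finset.mem_filter.1 he).2]
  change ∑ v, a v * c v ≤ ∑ v, (6 - 4 * √2) * (a v / 2 + c v) at hv
  rw [← Finset.mul_sum, Finset.sum_add_distrib, ← Finset.sum_div, hcsum, hacsum] at hv
  have hres' : ∑ e ∈ crucial ε p E M, matchProb p E M e * residual ε p E M e =
      ∑ e ∈ crucial ε p E M, matchProb p E M e -
        ∑ e ∈ crucial ε p E M, a (h e) * matchProb p E M e := by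
    rw [← Finset.sum_sub_distrib]
    refine Finset.sum_congr rfl fun e _ => ?_
    rw [hres e]
    ring
  have hN := sum_nonCrucialWeight_le (ε := ε) (E := E) (M := M) hp0 hp1
  rw [opt_eq_sum_matchProb hM,
    ← sum_nonCrucial_add_sum_crucial (ε := ε) (p := p) (M := M), hres']
  have hs : √2 * √2 = 2 := Real.mul_self_sqrt (by norm_num)
  have hs1 : √2 ≤ 1.5 := by nlinarith [Real.sqrt_nonneg 2]
  have hN' := mul_le_mul_of_nonneg_left hN (show 0 ≤ 6 - 4 * √2 by linarith)
  linarith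

theorem four_sqrt_two_sub_five_nonneg : 0 ≤ 4 * √2 - 5 := by
  have : (1.25 : ℝ) ≤ √2 := Real.le_sqrt_of_sq_le (by norm_num)
  linarith

theorem opt_nonneg (hp0 : 0 ≤ p) (hp1 : p ≤ 1) : 0 ≤ opt p E M :=
  expect_nonneg hp0 hp1 fun _ _ => Nat.cast_nonneg _

/-! ### The guarantees of the fractional matching and of the algorithm -/

variable [Fintype V]

theorem expectedFracSize_eq (hM : IsMaxMatchingRule E M) (hp0 : 0 ≤ p) (hp1 : p ≤ 1) :
    expectedFracSize ε p E M =
      expectRounds p E (numRounds ε p) (fun 𝓔 => expect p E (fun A =>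
        ∑ e ∈ E, fracN ε p E M 𝓔 A e)) +
      expectRounds p E (numRounds ε p) (fun 𝓔 => expect p E (fun B =>
        ∑ e ∈ E, fracC ε p E M (M B ∩ (querySet M 𝓔 ∩ crucial ε p E M)) e)) := by
  rw [← expectRounds_add]
  refine expectRounds_congr p fun 𝓔 _ => ?_
  set T := querySet M 𝓔 ∩ crucial ε p E M with hT
  have h1 : ∀ A : Finset (Sym2 V), ∑ μ ∈ (T ∩ A).powerset, appearProb p E M T (T ∩ A) μ *
      ∑ e ∈ E, frac ε p E M 𝓔 A μ e =
      (∑ e ∈ E, fracN ε p E M 𝓔 A e) * ∑ μ ∈ (T ∩ A).powerset, appearProb p E M T (T ∩ A) μ +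
      ∑ μ ∈ (T ∩ A).powerset, appearProb p E M T (T ∩ A) μ * ∑ e ∈ E, fracC ε p E M μ e := by
    intro A
    rw [Finset.mul_sum, ← Finset.sum_add_distrib]
    refine Finset.sum_congr rfl fun μ hμ => ?_
    have hμC : μ ⊆ crucial ε p E M := fun e he =>
      (Finset.mem_inter.1 (Finset.mem_inter.1 (Finset.mem_powerset.1 hμ he)).1).2
    simp_rw [frac_eq_add hμC, Finset.sum_add_distrib]
    ring
  -- the appearance probabilities sum to one at every realization of positive probability
  have h2 : ∀ A ∈ E.powerset,
      realProb p E A * ∑ μ ∈ (T ∩ A).powerset, appearProb p E M T (T ∩ A) μ = realProb p E A := by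
    have hle : ∀ A ∈ E.powerset, realProb p E A *
        ∑ μ ∈ (T ∩ A).powerset, appearProb p E M T (T ∩ A) μ ≤ realProb p E A := fun A _ =>
      mul_le_of_le_one_right (realProb_nonneg hp0 hp1 A) (sum_appearProb_le_one hp0 hp1 _ _)
    refine (Finset.sum_eq_sum_iff_of_le hle).1 ?_
    have := expect_sum_appearProb hM hp0 hp1 T (fun _ => 1)
    rw [expect_const] at this
    simp only [mul_one] at this
    have h3 := expect_const (E := E) p 1
    simp only [expect, mul_one] at this h3
    rw [this, h3]
  simp_rw [h1]
  rw [expect_add, expect_sum_appearProb hM hp0 hp1 T (fun μ => ∑ e ∈ E, fracC ε p E M μ e)]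
  congr 1
  refine Finset.sum_congr rfl fun A hA => ?_
  rw [mul_left_comm, h2 A hA, mul_comm]

theorem expectedFracSize_ge (hM : IsMaxMatchingRule E M) (hε0 : 0 < ε)
    (hε1 : ε ≤ Real.exp (-1)) (hp0 : 0 < p) (hp1 : p ≤ 1) :
    (1 - ε) * (1 - ε / 100) * ((4 * √2 - 5) * opt p E M) ≤ expectedFracSize ε p E M := by
  have hε := le_of_le_exp_neg_one hε1
  rw [expectedFracSize_eq hM hp0.le hp1]
  have h1 := expected_sum_fracN_ge hM hε0 hε1 hp0 hp1
  have h2 := expected_sum_fracC_ge hM hε0 hε1 hp0 hp1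
  have hf : 0 ≤ (1 - ε) * (1 - ε / 100) := mul_nonneg (by linarith) (by linarith)
  have h3 := mul_le_mul_of_nonneg_left (sum_residual_ge (ε := ε) hM hp0.le hp1) hf
  have hQ : 0 ≤ ∑ e ∈ nonCrucial ε p E M, matchProb p E M e :=
    Finset.sum_nonneg fun e _ => matchProb_nonneg hp0.le hp1 e
  have h4 : (1 - ε) * (1 - ε / 100) * ∑ e ∈ nonCrucial ε p E M, matchProb p E M e ≤
      (1 - ε / 2) * ∑ e ∈ nonCrucial ε p E M, matchProb p E M e :=
    mul_le_mul_of_nonneg_right (by nlinarith) hQ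
  linarith

theorem expectedFracSize_le (hM : IsMaxMatchingRule E M) (hE : ∀ e ∈ E, ¬ e.IsDiag) (hε0 : 0 < ε)
    (hε1 : ε ≤ Real.exp (-1)) (hp0 : 0 < p) (hp1 : p ≤ 1) :
    expectedFracSize ε p E M ≤ (1 + ε ^ 2 / 4) * algValue ε p E M := by
  unfold expectedFracSize algValue
  rw [← expectRounds_const_mul]
  refine expectRounds_mono hp0.le hp1 fun 𝓔 h𝓔 => ?_
  rw [← expect_const_mul]
  refine expect_mono hp0.le hp1 fun A hA => ?_
  have hb : 0 ≤ (1 + ε ^ 2 / 4) * ((M (querySet M 𝓔 ∩ A)).card : ℝ) := by positivity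
  set T := querySet M 𝓔 ∩ crucial ε p E M with hT
  have h1 : ∑ μ ∈ (T ∩ A).powerset, appearProb p E M T (T ∩ A) μ *
      ∑ e ∈ E, frac ε p E M 𝓔 A μ e ≤
      ∑ μ ∈ (T ∩ A).powerset, appearProb p E M T (T ∩ A) μ *
        ((1 + ε ^ 2 / 4) * ((M (querySet M 𝓔 ∩ A)).card : ℝ)) := by
    refine Finset.sum_le_sum fun μ hμ => ?_
    rcases (appearProb_nonneg hp0.le hp1 T (T ∩ A) μ).eq_or_lt with h0 | h0
    · rw [← h0, zero_mul, zero_mul]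
    · refine mul_le_mul_of_nonneg_left ?_ h0.le
      obtain ⟨B, hB, rfl⟩ := exists_of_appearProb_pos h0
      exact sum_frac_le_card hM hE hε0 hε1 hp0 hp1 h𝓔 (Finset.mem_powerset.1 hμ)
        ((hM B hB).2.1.subset Finset.inter_subset_left)
  refine h1.trans ?_
  rw [← Finset.sum_mul]
  exact mul_le_of_le_one_left hb (sum_appearProb_le_one hp0.le hp1 _ _)

theorem algValue_ge (hM : IsMaxMatchingRule E M) (hE : ∀ e ∈ E, ¬ e.IsDiag) (hε0 : 0 < ε)
    (hε1 : ε ≤ Real.exp (-1)) (hp0 : 0 < p) (hp1 : p ≤ 1) :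
    (1 - 2 * ε) * (4 * √2 - 5) * opt p E M ≤ algValue ε p E M := by
  have hε := le_of_le_exp_neg_one hε1
  have hnn : 0 ≤ (4 * √2 - 5) * opt p E M :=
    mul_nonneg four_sqrt_two_sub_five_nonneg (opt_nonneg hp0.le hp1)
  have hβ : 0 < 1 + ε ^ 2 / 4 := by positivity
  refine le_of_mul_le_mul_left ?_ hβ
  refine le_trans ?_ ((expectedFracSize_ge hM hε0 hε1 hp0 hp1).trans
    (expectedFracSize_le hM hE hε0 hε1 hp0 hp1))
  have h1 : (1 + ε ^ 2 / 4) * (1 - 2 * ε) ≤ (1 - ε) * (1 - ε / 100) := by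
    nlinarith [mul_pos hε0 hε0]
  have := mul_le_mul_of_nonneg_right h1 hnn
  linarith

end CrucialExpected

/-! ### The number of queries -/

theorem exists_numRounds_le {ε : ℝ} (hε0 : 0 < ε) (hε1 : ε ≤ Real.exp (-1)) :
    ∃ K : ℝ, 0 < K ∧ ∀ p : ℝ, 0 < p → p ≤ 1 / 2 →
      (numRounds ε p : ℝ) ≤ K * (Real.log (1 / p) / p) := by
  have hL := one_le_log_one_div hε0 hε1
  set L := Real.log (1 / ε) with hLd
  refine ⟨2000 * L * (2 * L + 1) / ε ^ 4 + 2, by positivity, fun p hp0 hp2 => ?_⟩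
  have hl : 1 / 2 ≤ Real.log (1 / p) := by
    have h1 : Real.log 2 ≤ Real.log (1 / p) := by
      refine Real.log_le_log (by norm_num) ?_
      rw [le_div_iff₀ hp0]; linarith
    have := Real.log_two_gt_d9
    linarith
  set l := Real.log (1 / p) with hld
  have hsplit : Real.log (1 / (ε * p)) = L + l := by
    rw [← one_div_mul_one_div, Real.log_mul (by positivity) (by positivity)]
  unfold numRounds
  rw [hsplit]
  have hnn : 0 ≤ 2000 * L * (L + l) / (ε ^ 4 * p) := by positivity
  refine (Nat.ceil_lt_add_one hnn).le.trans ?_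
  have h1 : 2000 * L * (L + l) / (ε ^ 4 * p) ≤ 2000 * L * (2 * L + 1) / ε ^ 4 * (l / p) := by
    have : 2000 * L * (2 * L + 1) / ε ^ 4 * (l / p) =
        2000 * L * ((2 * L + 1) * l) / (ε ^ 4 * p) := by
      field_simp
    rw [this]
    gcongr
    nlinarith
  have h2 : 1 ≤ 2 * (l / p) := by
    rw [← mul_div_assoc, le_div_iff₀ hp0]
    linarith
  linarith

end StochMatching

theorem mainTheorem1 :
    -- guarantees for every accuracy, realization probability, graph and maximum matching rule
    (∀ (ε p : ℝ), 0 < ε → ε ≤ Real.exp (-1) → 0 < p → p ≤ 1 →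
      ∀ (V : Type*) [Fintype V] [DecidableEq V] (G : SimpleGraph V) [DecidableRel G.Adj]
        (M : Finset (Sym2 V) → Finset (Sym2 V)), IsMaxMatchingRule G.edgeFinset M →
      -- in every outcome, `x` is a fractional matching on the realized queried edges
      (∀ 𝓔 : Fin (numRounds ε p) → Finset (Sym2 V), (∀ r, 𝓔 r ⊆ G.edgeFinset) →
        ∀ A ⊆ G.edgeFinset, ∀ μ ⊆ querySet M 𝓔 ∩ crucial ε p G.edgeFinset M ∩ A,
          0 < appearProb p G.edgeFinset M (querySet M 𝓔 ∩ crucial ε p G.edgeFinset M)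
            (querySet M 𝓔 ∩ crucial ε p G.edgeFinset M ∩ A) μ →
          IsFractionalMatching (querySet M 𝓔 ∩ A) (frac ε p G.edgeFinset M 𝓔 A μ)) ∧
      -- its expected size
      (1 - 2 * ε) * (4 * Real.sqrt 2 - 5) * opt p G.edgeFinset M
        ≤ expectedFracSize ε p G.edgeFinset M ∧
      -- the approximation factor of the algorithm
      (1 - 2 * ε) * (4 * Real.sqrt 2 - 5) * opt p G.edgeFinset M
        ≤ algValue ε p G.edgeFinset M ∧
      -- the number of queries per vertex
      (∀ 𝓔 : Fin (numRounds ε p) → Finset (Sym2 V), (∀ r, 𝓔 r ⊆ G.edgeFinset) →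
        ∀ v : V, queriesAt M 𝓔 v ≤ numRounds ε p)) ∧
    -- for fixed `ε`, the number of queries per vertex is `O(log(1/p)/p)`
    (∀ ε : ℝ, 0 < ε → ε ≤ Real.exp (-1) → ∃ K : ℝ, 0 < K ∧
      ∀ p : ℝ, 0 < p → p ≤ 1 / 2 →
      ∀ (V : Type*) [Fintype V] [DecidableEq V] (G : SimpleGraph V) [DecidableRel G.Adj]
        (M : Finset (Sym2 V) → Finset (Sym2 V)), IsMaxMatchingRule G.edgeFinset M →
      ∀ 𝓔 : Fin (numRounds ε p) → Finset (Sym2 V), (∀ r, 𝓔 r ⊆ G.edgeFinset) →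
        ∀ v : V, (queriesAt M 𝓔 v : ℝ) ≤ K * (Real.log (1 / p) / p)) ∧
    -- a suitable constant `ε` gives every factor below `4√2 - 5`
    (∀ c : ℝ, c < 4 * Real.sqrt 2 - 5 → ∃ ε : ℝ, 0 < ε ∧ ε ≤ Real.exp (-1) ∧
      ∀ p : ℝ, 0 < p → p ≤ 1 →
      ∀ (V : Type*) [Fintype V] [DecidableEq V] (G : SimpleGraph V) [DecidableRel G.Adj]
        (M : Finset (Sym2 V) → Finset (Sym2 V)), IsMaxMatchingRule G.edgeFinset M →
      c * opt p G.edgeFinset M ≤ algValue ε p G.edgeFinset M) := by 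
  refine ⟨?_, ?_, ?_⟩
  · intro ε p hε0 hε1 hp0 hp1 V _ _ G _ M hM
    have hE : ∀ e ∈ G.edgeFinset, ¬ e.IsDiag := fun e he =>
      G.not_isDiag_of_mem_edgeSet (SimpleGraph.mem_edgeFinset.1 he)
    refine ⟨fun 𝓔 h𝓔 A _ μ hμ hpos => ?_, ?_, algValue_ge hM hE hε0 hε1 hp0 hp1,
      fun 𝓔 h𝓔 v => queriesAt_le hM h𝓔 v⟩
    · obtain ⟨B, hB, rfl⟩ := exists_of_appearProb_pos hpos
      exact isFractionalMatching_frac hM hε0 hε1 hp0 hp1 h𝓔 hμ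
        ((hM B hB).2.1.subset Finset.inter_subset_left)
    · refine le_trans ?_ (expectedFracSize_ge hM hε0 hε1 hp0 hp1)
      rw [mul_assoc]
      refine mul_le_mul_of_nonneg_right (by nlinarith) ?_
      exact mul_nonneg four_sqrt_two_sub_five_nonneg (opt_nonneg hp0.le hp1)
  · intro ε hε0 hε1
    obtain ⟨K, hK0, hK⟩ := exists_numRounds_le hε0 hε1
    refine ⟨K, hK0, fun p hp0 hp2 V _ _ G _ M hM 𝓔 h𝓔 v => ?_⟩
    exact le_trans (by exact_mod_cast queriesAt_le hM h𝓔 v) (hK p hp0 hp2)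
  · intro c hc
    set κ := 4 * √2 - 5 with hκ
    have hκ0 : 0 ≤ κ := four_sqrt_two_sub_five_nonneg
    -- `κ ≤ 1`, so `2 ε κ ≤ κ - c` as soon as `ε ≤ (κ - c) / 2`
    have hκ1 : κ ≤ 1 := by
      have : √2 ≤ 1.5 := Real.sqrt_le_iff.2 ⟨by norm_num, by norm_num⟩
      linarith
    have hε0 : 0 < min (Real.exp (-1)) ((κ - c) / 2) :=
      lt_min (Real.exp_pos _) (by linarith)
    refine ⟨min (Real.exp (-1)) ((κ - c) / 2), hε0, min_le_left _ _,
      fun p hp0 hp1 V _ _ G _ M hM => ?_⟩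
    have hE : ∀ e ∈ G.edgeFinset, ¬ e.IsDiag := fun e he =>
      G.not_isDiag_of_mem_edgeSet (SimpleGraph.mem_edgeFinset.1 he)
    refine le_trans ?_ (algValue_ge hM hE hε0 (min_le_left _ _) hp0 hp1)
    refine mul_le_mul_of_nonneg_right ?_ (opt_nonneg hp0.le hp1)
    have h2 := min_le_right (Real.exp (-1)) ((κ - c) / 2)
    have h3 := mul_le_of_le_one_right hε0.le hκ1
    linarith
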